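/- Let $n\ge 2$. Let $\mathcal K^n$ be the class of nonempty compact convex subsets of $\mathbb R^n$, let $\mathcal K^n_s$ be the class of those $K\in\mathcal K^n$ with $K=-K$, and let $o$ be the origin. For $K\in\mathcal K^n$ let $h_K(x)=\sup\{x\cdot y:y\in K\}$ be the support function. For $1\le p\le\infty$ and $K,L\in\mathcal K^n_s$, the $L_p$ sum $K+_pL$ is the compact convex set with $h_{K+_pL}=(h_K^p+h_L^p)^{1/p}$ if $p<\infty$, and $h_{K+_\infty L}=\max\{h_K,h_L\}$. For $M\subset\mathbb R^2$ let $K\oplus_ML=\{ax+by:x\in K,\ y\in L,\ (a,b)\in M\}$. Let $*:(\mathcal K^n_s)^2\to\mathcal K^n$ be an operation. It is called projection covariant if $(K*L)|S=(K|S)*(L|S)$ for all $K,L\in\mathcal K^n_s$ and all linear subspaces $S$ of $\mathbb R^n$ with $1\le\dim S\le n-1$, where $|S$ denotes orthogonal projection onto $S$; $GL(n)$ covariant if $\phi(K*L)=\phi K*\phi L$ for all $K,L\in\mathcal K^n_s$ and $\phi\in GL(n)$; continuous if it is (jointly) continuous in the Hausdorff metric; associative if $K*(L*N)=(K*L)*N$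 for all $K,L,N\in\mathcal K^n_s$ for which both sides make sense, i.e. for which $L*N$ and $K*L$ belong to $\mathcal K^n_s$; and it has the identity property if $K*\{o\}=K=\{o\}*K$ for all $K\in\mathcal K^n_s$. Then: 1. $*$ is projection covariant if and only if it is continuous and $GL(n)$ covariant. 2. If $*$ is projection covariant, then $K*L\in\mathcal K^n_s$ for all $K,L\in\mathcal K^n_s$ (so both sides of the associativity equation always make sense). 3. $*$ is projection covariant and associative if and only if $*=\oplus_M$, where either $M=\{o\}$, or $M=[-e_1,e_1]$, or $M=[-e_2,e_2]$, or $M$ is the closed unit ball of $\ell^2_p$ for some $1\le p\le\infty$. 4. $*$ is projection covariant and associative if and only if either $K*L=\{o\}$ for all $K,L\in\mathcal K^n_s$, or $K*L=K$ for all $K,L\in\mathcal K^n_s$, or $K*L=L$ for all $K,L\in\mathcal K^n_s$, or $*=+_p$ for some $1\le p\le\infty$. 5. $*$ is continuous, $GL(n)$ covariant, associative, and has the identity property if and only if $*=+_p$ for some $1\le p\le\infty$. The same holds with "projection covariant" in place of "continuous, $GL(n)$ covariant". -/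

import Mathlib

open scoped ENNReal

namespace ConvexOps

/-- Euclidean `n`-space. -/
abbrev Eucl (n : ℕ) : Type := EuclideanSpace ℝ (Fin n)

/-- The nonempty compact convex subsets of `ℝⁿ`. Mathlib's `ConvexBody` requires no interior
points, and its metric is the Hausdorff metric. -/
abbrev CompactConvex (n : ℕ) : Type := ConvexBody (Eucl n)

/-- Central symmetry of a set with respect to the origin. -/
def IsOSymm {n : ℕ} (A : Set (Eucl n)) : Prop := ∀ x ∈ A, -x ∈ A

/-- The `o`-symmetric nonempty compact convex subsets of `ℝⁿ` (with the Hausdorff metric, as a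
subtype). -/
abbrev SymmCompactConvex (n : ℕ) : Type :=
  {K : CompactConvex n // IsOSymm (K : Set (Eucl n))}

/-- An operation assigning a compact convex set to two `o`-symmetric compact convex sets. -/
abbrev BinOp (n : ℕ) : Type := SymmCompactConvex n → SymmCompactConvex n → CompactConvex n

/-- The image of a compact convex set under a linear map. -/
def mapBody {n : ℕ} (f : Eucl n →L[ℝ] Eucl n) (K : CompactConvex n) : CompactConvex n where
  carrier := f '' (K : Set (Eucl n))
  convex' := K.convex.is_linear_image f.toLinearMap.isLinear
  isCompact' := K.isCompact.image f.continuous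
  nonempty' := K.nonempty.image f

theorem isOSymm_mapBody {n : ℕ} (f : Eucl n →L[ℝ] Eucl n) {K : CompactConvex n}
    (hK : IsOSymm (K : Set (Eucl n))) : IsOSymm (mapBody f K : Set (Eucl n)) := by
  rintro _ ⟨x, hx, rfl⟩
  exact ⟨-x, hK x hx, map_neg f x⟩

/-- The image of an `o`-symmetric compact convex set under a linear map. -/
def mapSymm {n : ℕ} (f : Eucl n →L[ℝ] Eucl n) (K : SymmCompactConvex n) : SymmCompactConvex n :=
  ⟨mapBody f K.1, isOSymm_mapBody f K.2⟩

/-- The set `{o}`. -/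
def originSymm (n : ℕ) : SymmCompactConvex n :=
  ⟨0, by intro x hx; simpa using hx⟩

/-! ### Properties of operations -/

/-- Projection covariance: `(K * L)|S = (K|S) * (L|S)` for all subspaces `S` with
`1 ≤ dim S ≤ n - 1`, where `|S` is orthogonal projection onto `S`. -/
def ProjectionCovariant {n : ℕ} (op : BinOp n) : Prop :=
  ∀ S : Submodule ℝ (Eucl n), 1 ≤ Module.finrank ℝ S → Module.finrank ℝ S < n →
    ∀ K L : SymmCompactConvex n,
      mapBody S.starProjection (op K L)
        = op (mapSymm S.starProjection K) (mapSymm S.starProjection L)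

/-- `GL(n)` covariance: `φ(K * L) = φK * φL` for all invertible linear maps `φ`. -/
def GLCovariant {n : ℕ} (op : BinOp n) : Prop :=
  ∀ φ : Eucl n ≃L[ℝ] Eucl n, ∀ K L : SymmCompactConvex n,
    mapBody (φ : Eucl n →L[ℝ] Eucl n) (op K L)
      = op (mapSymm (φ : Eucl n →L[ℝ] Eucl n) K) (mapSymm (φ : Eucl n →L[ℝ] Eucl n) L)

/-- Continuity in the Hausdorff metric, jointly in both variables. -/
def HausdorffContinuous {n : ℕ} (op : BinOp n) : Prop :=
  Continuous fun P : SymmCompactConvex n × SymmCompactConvex n => op P.1 P.2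

/-- Associativity: `K * (L * M) = (K * L) * M` for all `K, L, M` for which both sides make sense,
that is, for which `L * M` and `K * L` are again `o`-symmetric. -/
def Associative {n : ℕ} (op : BinOp n) : Prop :=
  ∀ (K L M : SymmCompactConvex n) (hLM : IsOSymm (op L M : Set (Eucl n)))
    (hKL : IsOSymm (op K L : Set (Eucl n))),
    op K ⟨op L M, hLM⟩ = op ⟨op K L, hKL⟩ M

/-- The identity property: `K * {o} = K = {o} * K`. -/
def HasIdentity {n : ℕ} (op : BinOp n) : Prop :=
  ∀ K : SymmCompactConvex n, op K (originSymm n) = K.1 ∧ op (originSymm n) K = K.1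

/-! ### `M`-addition -/

/-- The `M`-sum `{a x + b y : x ∈ K, y ∈ L, (a, b) ∈ M}` of two sets, for `M ⊆ ℝ²`. -/
def mSum {n : ℕ} (M : Set (ℝ × ℝ)) (K L : Set (Eucl n)) : Set (Eucl n) :=
  {z | ∃ x ∈ K, ∃ y ∈ L, ∃ m ∈ M, z = m.1 • x + m.2 • y}

/-- The closed unit ball of `ℓₚ²`. -/
def lpUnitBall (p : ℝ≥0∞) : Set (ℝ × ℝ) := {m | ‖WithLp.toLp p m‖ ≤ 1}

/-- The operation `op` is `M`-addition. -/
def IsMAddition {n : ℕ} (op : BinOp n) (M : Set (ℝ × ℝ)) : Prop :=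
  ∀ K L : SymmCompactConvex n,
    (op K L : Set (Eucl n)) = mSum M (K.1 : Set (Eucl n)) (L.1 : Set (Eucl n))

/-! ### Support functions and `Lₚ` addition -/

/-- The support function `h_K(x) = sup {x · y : y ∈ K}`. -/
noncomputable def supportFn {n : ℕ} (K : CompactConvex n) (x : Eucl n) : ℝ :=
  sSup ((fun y => inner ℝ x y) '' (K : Set (Eucl n)))

/-- `(aᵖ + bᵖ)^(1/p)` for `p < ∞`, and `max a b` for `p = ∞` (for `a, b ≥ 0`). -/
noncomputable def lpCombine (p : ℝ≥0∞) (a b : ℝ) : ℝ :=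
  if p = ∞ then max a b else (a ^ p.toReal + b ^ p.toReal) ^ (1 / p.toReal)

theorem bddAbove_inner_image {n : ℕ} (K : CompactConvex n) (x : Eucl n) :
    BddAbove ((fun y => inner ℝ x y) '' (K : Set (Eucl n))) :=
  (K.isCompact.image (by fun_prop)).bddAbove

theorem inner_le_supportFn {n : ℕ} (K : CompactConvex n) (x : Eucl n) {y : Eucl n}
    (hy : y ∈ (K : Set (Eucl n))) : inner ℝ x y ≤ supportFn K x :=
  le_csSup (bddAbove_inner_image K x) ⟨y, hy, rfl⟩

theorem supportFn_le {n : ℕ} (K : CompactConvex n) (x : Eucl n) {c : ℝ}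
    (h : ∀ y ∈ (K : Set (Eucl n)), inner ℝ x y ≤ c) : supportFn K x ≤ c := by
  refine csSup_le (K.nonempty.image _) ?_
  rintro _ ⟨y, hy, rfl⟩
  exact h y hy

theorem supportFn_add_le {n : ℕ} (K : CompactConvex n) (x y : Eucl n) :
    supportFn K (x + y) ≤ supportFn K x + supportFn K y := by
  refine supportFn_le K _ fun z hz => ?_
  rw [inner_add_left]
  exact add_le_add (inner_le_supportFn K x hz) (inner_le_supportFn K y hz)

theorem supportFn_smul {n : ℕ} (K : CompactConvex n) {c : ℝ} (hc : 0 < c) (x : Eucl n) :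
    supportFn K (c • x) = c * supportFn K x := by
  have key : ∀ {c : ℝ}, 0 < c → ∀ x : Eucl n, supportFn K (c • x) ≤ c * supportFn K x := by
    intro c hc x
    refine supportFn_le K _ fun z hz => ?_
    rw [real_inner_smul_left]
    exact mul_le_mul_of_nonneg_left (inner_le_supportFn K x hz) hc.le
  refine le_antisymm (key hc x) ?_
  have h := key (inv_pos.mpr hc) (c • x)
  rw [smul_smul, inv_mul_cancel₀ hc.ne', one_smul] at h
  calc c * supportFn K x ≤ c * (c⁻¹ * supportFn K (c • x)) :=
        mul_le_mul_of_nonneg_left h hc.le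
    _ = supportFn K (c • x) := by rw [← mul_assoc, mul_inv_cancel₀ hc.ne', one_mul]

theorem supportFn_nonneg {n : ℕ} (K : SymmCompactConvex n) (x : Eucl n) :
    0 ≤ supportFn K.1 x := by
  have h := inner_le_supportFn K.1 x (K.1.zero_mem_of_symmetric K.2)
  rwa [inner_zero_right] at h

/-- A compact convex set is determined by its support function. -/
theorem eq_of_supportFn_eq {n : ℕ} {K L : CompactConvex n}
    (h : ∀ x, supportFn K x = supportFn L x) : K = L := by
  have key : ∀ K L : CompactConvex n, (∀ x, supportFn K x = supportFn L x) →
      (K : Set (Eucl n)) ⊆ L := by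
    intro K L h y hy
    by_contra hyL
    obtain ⟨f, u, hf, hu⟩ := geometric_hahn_banach_closed_point L.convex L.isClosed hyL
    set x := (InnerProductSpace.toDual ℝ (Eucl n)).symm f with hx
    have hfx : ∀ z, inner ℝ x z = f z := fun z => by
      rw [hx, InnerProductSpace.toDual_symm_apply]
    have h1 : supportFn L x ≤ u := supportFn_le L x fun z hz => by
      rw [hfx]; exact (hf z hz).le
    have h2 := inner_le_supportFn K x hy
    rw [hfx, h x] at h2
    linarith
  exact ConvexBody.ext (Set.Subset.antisymm (key K L h) (key L K fun x => (h x).symm))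

/-- A supporting point of a sublinear function. -/
theorem exists_supporting {n : ℕ} {g : Eucl n → ℝ}
    (hom : ∀ c : ℝ, 0 < c → ∀ x, g (c • x) = c * g x)
    (sub : ∀ x y, g (x + y) ≤ g x + g y) (x : Eucl n) :
    ∃ y : Eucl n, inner ℝ x y = g x ∧ ∀ z, inner ℝ z y ≤ g z := by
  have g0 : g 0 = 0 := by
    have := hom 2 (by norm_num) 0
    rw [smul_zero] at this
    linarith
  have mk : ∀ φ : Eucl n →ₗ[ℝ] ℝ, φ x = g x → (∀ z, φ z ≤ g z) →
      ∃ y : Eucl n, inner ℝ x y = g x ∧ ∀ z, inner ℝ z y ≤ g z := by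
    intro φ h1 h2
    refine ⟨(InnerProductSpace.toDual ℝ (Eucl n)).symm (LinearMap.toContinuousLinearMap φ),
      ?_, fun z => ?_⟩
    · rw [real_inner_comm, InnerProductSpace.toDual_symm_apply]; exact h1
    · rw [real_inner_comm, InnerProductSpace.toDual_symm_apply]; exact h2 z
  by_cases hx : x = 0
  · obtain ⟨φ, -, h2⟩ := exists_extension_of_le_sublinear (⊥ : Eucl n →ₗ.[ℝ] ℝ) g hom sub (by
      rintro ⟨z, hz⟩
      have hz0 : z = 0 := (Submodule.mem_bot ℝ).mp hz
      subst hz0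
      have : (⟨0, hz⟩ : (⊥ : Eucl n →ₗ.[ℝ] ℝ).domain) = 0 := rfl
      rw [this, LinearPMap.map_zero]
      exact g0.ge)
    exact mk φ (by rw [hx, map_zero, g0]) h2
  · obtain ⟨φ, h1, h2⟩ := exists_extension_of_le_sublinear
      (LinearPMap.mkSpanSingleton (K := ℝ) x (g x) hx) g hom sub (by
        rintro ⟨z, hz⟩
        obtain ⟨c, rfl⟩ := Submodule.mem_span_singleton.mp hz
        have hval : LinearPMap.mkSpanSingleton (K := ℝ) x (g x) hx ⟨c • x, hz⟩ = c * g x :=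
          LinearPMap.mkSpanSingleton'_apply x (g x) _ c hz
        rw [hval]
        change c * g x ≤ g (c • x)
        rcases lt_trichotomy c 0 with hc | hc | hc
        · have h3 := hom (-c) (by linarith) x
          have h4 := sub (c • x) ((-c) • x)
          rw [← add_smul, add_neg_cancel, zero_smul, g0] at h4
          linarith
        · rw [hc, zero_smul, g0, zero_mul]
        · rw [hom c hc])
    refine mk φ ?_ h2
    have h5 := h1 ⟨x, Submodule.mem_span_singleton_self x⟩
    rw [LinearPMap.mkSpanSingleton_apply] at h5
    exact h5

/-- A sublinear function is the support function of a unique compact convex set. -/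
theorem existsUnique_supportFn_eq {n : ℕ} {g : Eucl n → ℝ}
    (hom : ∀ c : ℝ, 0 < c → ∀ x, g (c • x) = c * g x)
    (sub : ∀ x y, g (x + y) ≤ g x + g y) :
    ∃! N : CompactConvex n, ∀ x, supportFn N x = g x := by
  have hclosed : IsClosed {y : Eucl n | ∀ z, inner ℝ z y ≤ g z} := by
    simp only [Set.ofPred_forall]
    exact isClosed_iInter fun z => isClosed_le (by fun_prop) continuous_const
  have hcompact : IsCompact {y : Eucl n | ∀ z, inner ℝ z y ≤ g z} := by
    refine IsCompact.of_isClosed_subset ((isCompact_univ_pi fun i : Fin n =>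
      isCompact_Icc (a := -g (-EuclideanSpace.single i (1 : ℝ)))
        (b := g (EuclideanSpace.single i (1 : ℝ)))).image
          (PiLp.continuous_toLp 2 fun _ : Fin n => ℝ)) hclosed ?_
    intro y hy
    refine ⟨WithLp.ofLp y, fun i _ => ⟨?_, ?_⟩, rfl⟩
    · have h := hy (-EuclideanSpace.single i (1 : ℝ))
      rw [inner_neg_left, EuclideanSpace.inner_single_left] at h
      simp only [map_one, one_mul] at h
      linarith
    · have h := hy (EuclideanSpace.single i (1 : ℝ))
      rw [EuclideanSpace.inner_single_left] at h
      simpa using h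
  have hconvex : Convex ℝ {y : Eucl n | ∀ z, inner ℝ z y ≤ g z} := by
    intro a ha b hb s t hs ht hst z
    rw [inner_add_right, real_inner_smul_right, real_inner_smul_right]
    calc s * inner ℝ z a + t * inner ℝ z b ≤ s * g z + t * g z :=
          add_le_add (mul_le_mul_of_nonneg_left (ha z) hs) (mul_le_mul_of_nonneg_left (hb z) ht)
      _ = g z := by rw [← add_mul, hst, one_mul]
  obtain ⟨y0, -, hy0⟩ := exists_supporting hom sub 0
  have hN : ∀ x, supportFn (⟨_, hconvex, hcompact, ⟨y0, hy0⟩⟩ : CompactConvex n) x = g x := by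
    intro x
    refine le_antisymm (supportFn_le _ x fun y hy => hy x) ?_
    obtain ⟨y, hy1, hy2⟩ := exists_supporting hom sub x
    rw [← hy1]
    exact inner_le_supportFn _ x hy2
  exact ⟨_, hN, fun N' h' => eq_of_supportFn_eq fun x => (h' x).trans (hN x).symm⟩

theorem lpCombine_eq_norm {p : ℝ≥0∞} (hp : 1 ≤ p) {a b : ℝ} (ha : 0 ≤ a) (hb : 0 ≤ b) :
    lpCombine p a b = ‖WithLp.toLp p (a, b)‖ := by
  unfold lpCombine
  split_ifs with h
  · subst h
    rw [WithLp.prod_norm_eq_sup]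
    simp [abs_of_nonneg ha, abs_of_nonneg hb]
  · rw [WithLp.prod_norm_eq_add
      (ENNReal.toReal_pos (zero_lt_one.trans_le hp).ne' h)]
    simp [abs_of_nonneg ha, abs_of_nonneg hb]

theorem lpCombine_mono {p : ℝ≥0∞} {a b a' b' : ℝ} (ha : 0 ≤ a) (hb : 0 ≤ b)
    (haa : a ≤ a') (hbb : b ≤ b') : lpCombine p a b ≤ lpCombine p a' b' := by
  unfold lpCombine
  split_ifs with h
  · exact max_le_max haa hbb
  · have hp0 : 0 ≤ p.toReal := ENNReal.toReal_nonneg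
    exact Real.rpow_le_rpow (add_nonneg (Real.rpow_nonneg ha _) (Real.rpow_nonneg hb _))
      (add_le_add (Real.rpow_le_rpow ha haa hp0) (Real.rpow_le_rpow hb hbb hp0))
      (one_div_nonneg.mpr hp0)

theorem existsUnique_lpSum {n : ℕ} {p : ℝ≥0∞} (hp : 1 ≤ p) (K L : SymmCompactConvex n) :
    ∃! N : CompactConvex n,
      ∀ x, supportFn N x = lpCombine p (supportFn K.1 x) (supportFn L.1 x) := by
  have : Fact (1 ≤ p) := ⟨hp⟩
  refine existsUnique_supportFn_eq ?_ ?_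
  · intro c hc x
    rw [lpCombine_eq_norm hp (supportFn_nonneg K _) (supportFn_nonneg L _),
      lpCombine_eq_norm hp (supportFn_nonneg K _) (supportFn_nonneg L _),
      supportFn_smul _ hc, supportFn_smul _ hc]
    have h := norm_smul c (WithLp.toLp p (supportFn K.1 x, supportFn L.1 x))
    rw [Real.norm_of_nonneg hc.le] at h
    rw [← h]
    rfl
  · intro x y
    refine (lpCombine_mono (supportFn_nonneg K _) (supportFn_nonneg L _)
      (supportFn_add_le K.1 x y) (supportFn_add_le L.1 x y)).trans ?_
    rw [lpCombine_eq_norm hp (add_nonneg (supportFn_nonneg K _) (supportFn_nonneg K _))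
        (add_nonneg (supportFn_nonneg L _) (supportFn_nonneg L _)),
      lpCombine_eq_norm hp (supportFn_nonneg K _) (supportFn_nonneg L _),
      lpCombine_eq_norm hp (supportFn_nonneg K _) (supportFn_nonneg L _)]
    exact norm_add_le (WithLp.toLp p (supportFn K.1 x, supportFn L.1 x))
      (WithLp.toLp p (supportFn K.1 y, supportFn L.1 y))

/-- `Lₚ` addition, `1 ≤ p ≤ ∞`: the compact convex set `K +ₚ L` whose support function is
`(h_Kᵖ + h_Lᵖ)^(1/p)`, respectively `max {h_K, h_L}` if `p = ∞`. -/
noncomputable def lpAdd {n : ℕ} (p : ℝ≥0∞) (hp : 1 ≤ p) : BinOp n :=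
  fun K L => (existsUnique_lpSum hp K L).choose

theorem supportFn_lpAdd {n : ℕ} (p : ℝ≥0∞) (hp : 1 ≤ p) (K L : SymmCompactConvex n)
    (x : Eucl n) :
    supportFn (lpAdd p hp K L) x = lpCombine p (supportFn K.1 x) (supportFn L.1 x) :=
  (existsUnique_lpSum hp K L).choose_spec.1 x

end ConvexOps

/-! Everything reduces to one function of two real variables. The projection of an `o`-symmetric
body `K` onto the line through a unit vector `u` is the segment with endpoints `±h_K(u) u`, so
projection covariance forces `h_{K*L}(u)` to depend only on `h_K(u)`, `h_L(u)` and `u`. Comparing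
two lines at an angle shows that this dependence is positively homogeneous and the same for every
`u`. Subadditivity of support functions, tested on segments in a plane, makes it an absolute
seminorm `g`. Hence `h_{K*L} = g(h_K, h_L)` (`ProjectionCovariant.exists_isGivenBy`); this is where
`n ≥ 2` is needed.

Such a formula gives symmetric values and `GL(n)` covariance at once, and continuity because `g` is
Lipschitz. Conversely, orthogonal projections are limits of invertible maps, so continuity and
`GL(n)` covariance give projection covariance.

Associativity of the operation is associativity of `g` on `[0, ∞)`. It makes `g(1,0)` and `g(0,1)`
equal to `0` or `1`. If one of them vanishes, `g` ignores that variable. If both are `1`, the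
iterates `1 * ⋯ * 1` form a monotone completely multiplicative sequence, so they are powers `k ^ r`
unless `g` is the maximum; homogeneity and continuity then give `g(x ^ r, y ^ r) = (x + y) ^ r`, the
`ℓ_p` norm with `p = 1 / r` (`IsAbsSeminorm.classification_of_assoc`).

By Hölder duality, `L_q` addition is `M`-addition for the unit ball of the conjugate norm `ℓ_p`
(`coe_lpAdd_eq_mSum`), which turns one classification into the other. -/

namespace ConvexOps

/-! ### Support functions of images, symmetric bodies and segments -/

theorem supportFn_zero_right {n : ℕ} (K : CompactConvex n) : supportFn K 0 = 0 := by
  have h := supportFn_smul K (two_pos (α := ℝ)) 0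
  rw [smul_zero] at h
  linarith

theorem supportFn_smul_nonneg {n : ℕ} (K : CompactConvex n) {c : ℝ} (hc : 0 ≤ c) (x : Eucl n) :
    supportFn K (c • x) = c * supportFn K x := by
  rcases hc.eq_or_lt with rfl | hc
  · rw [zero_smul, supportFn_zero_right, zero_mul]
  · exact supportFn_smul K hc x

theorem supportFn_neg {n : ℕ} (K : SymmCompactConvex n) (x : Eucl n) :
    supportFn K.1 (-x) = supportFn K.1 x := by
  have key : ∀ x, supportFn K.1 (-x) ≤ supportFn K.1 x := fun x =>
    supportFn_le K.1 _ fun y hy => by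
      rw [inner_neg_left, ← inner_neg_right]
      exact inner_le_supportFn K.1 x (K.2 y hy)
  exact le_antisymm (key x) (by simpa using key (-x))

theorem supportFn_smul_symm {n : ℕ} (K : SymmCompactConvex n) (c : ℝ) (x : Eucl n) :
    supportFn K.1 (c • x) = |c| * supportFn K.1 x := by
  rcases le_total 0 c with hc | hc
  · rw [supportFn_smul_nonneg K.1 hc, abs_of_nonneg hc]
  · rw [← supportFn_neg, ← neg_smul, supportFn_smul_nonneg K.1 (neg_nonneg.mpr hc),
      abs_of_nonpos hc]

/-- The reflected body `-K` has support function `x ↦ h_K(-x)`, and a body is determined by its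
support function. -/
theorem isOSymm_of_supportFn_neg {n : ℕ} {K : CompactConvex n}
    (h : ∀ x, supportFn K (-x) = supportFn K x) : IsOSymm (K : Set (Eucl n)) := by
  have hK : mapBody (-ContinuousLinearMap.id ℝ (Eucl n)) K = K := by
    refine eq_of_supportFn_eq fun x => ?_
    rw [← h x]
    have himg : (mapBody (-ContinuousLinearMap.id ℝ (Eucl n)) K : Set (Eucl n))
        = (fun y => -y) '' (K : Set (Eucl n)) := rfl
    unfold supportFn
    rw [himg, Set.image_image]
    simp only [inner_neg_left, inner_neg_right]
  intro x hx
  have hmem : -x ∈ (mapBody (-ContinuousLinearMap.id ℝ (Eucl n)) K : Set (Eucl n)) :=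
    ⟨x, hx, by simp⟩
  rwa [hK] at hmem

theorem supportFn_mapBody {n : ℕ} (f : Eucl n →L[ℝ] Eucl n) (K : CompactConvex n) (x : Eucl n) :
    supportFn (mapBody f K) x = supportFn K (f.adjoint x) := by
  have : (mapBody f K : Set (Eucl n)) = f '' (K : Set (Eucl n)) := rfl
  unfold supportFn
  rw [this, Set.image_image]
  simp only [ContinuousLinearMap.adjoint_inner_left]

theorem supportFn_mapBody_starProjection {n : ℕ} (S : Submodule ℝ (Eucl n)) (K : CompactConvex n)
    (x : Eucl n) : supportFn (mapBody S.starProjection K) x = supportFn K (S.starProjection x) := by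
  have : (mapBody S.starProjection K : Set (Eucl n)) = S.starProjection '' (K : Set (Eucl n)) := rfl
  unfold supportFn
  rw [this, Set.image_image]
  simp only [← Submodule.inner_starProjection_left_eq_right]

/-- The segment `[-z, z]`. -/
def symmSegment {n : ℕ} (z : Eucl n) : SymmCompactConvex n :=
  ⟨{ carrier := (fun t : ℝ => t • z) '' Set.Icc (-1) 1
     convex' := (convex_Icc (-1 : ℝ) 1).is_linear_image
       (LinearMap.toSpanSingleton ℝ (Eucl n) z).isLinear
     isCompact' := isCompact_Icc.image (by fun_prop)
     nonempty' := ⟨0, 0, by simp, by simp⟩ }, by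
    rintro _ ⟨t, ht, rfl⟩
    exact ⟨-t, ⟨by linarith [ht.2], by linarith [ht.1]⟩, by simp⟩⟩

theorem supportFn_symmSegment {n : ℕ} (z x : Eucl n) :
    supportFn (symmSegment z).1 x = |inner ℝ x z| := by
  refine le_antisymm (supportFn_le _ x ?_) ?_
  · rintro _ ⟨t, ht, rfl⟩
    simp only [real_inner_smul_right]
    refine (le_abs_self _).trans ?_
    rw [abs_mul]
    exact mul_le_of_le_one_left (abs_nonneg _) (abs_le.mpr ht)
  · refine abs_le'.mpr ⟨inner_le_supportFn _ x ⟨1, by simp, by simp⟩, ?_⟩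
    rw [← inner_neg_right]
    exact inner_le_supportFn _ x ⟨-1, by simp, by simp⟩

theorem mapSymm_starProjection_span_singleton {n : ℕ} {u : Eucl n} (hu : ‖u‖ = 1)
    (K : SymmCompactConvex n) :
    mapSymm (Submodule.span ℝ {u}).starProjection K = symmSegment (supportFn K.1 u • u) := by
  refine Subtype.ext (eq_of_supportFn_eq fun x => ?_)
  change supportFn (mapBody _ K.1) x = _
  rw [supportFn_mapBody_starProjection, Submodule.starProjection_unit_singleton ℝ hu,
    supportFn_smul_symm, supportFn_symmSegment, real_inner_smul_right, abs_mul,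
    abs_of_nonneg (supportFn_nonneg K u), real_inner_comm, mul_comm]

/-! ### Operations given by absolute seminorms on the plane -/

/-- A seminorm on `ℝ²` that depends only on the absolute values of the coordinates. -/
structure IsAbsSeminorm (g : ℝ → ℝ → ℝ) : Prop where
  abs_abs : ∀ a b, g |a| |b| = g a b
  smul : ∀ c a b, 0 < c → g (c * a) (c * b) = c * g a b
  add_le : ∀ a b a' b', g (a + a') (b + b') ≤ g a b + g a' b'

namespace IsAbsSeminorm

variable {g : ℝ → ℝ → ℝ} (hg : IsAbsSeminorm g)
include hg

theorem zero : g 0 0 = 0 := by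
  have h := hg.smul 2 0 0 two_pos
  rw [mul_zero] at h
  linarith

theorem smul_nonneg {c : ℝ} (hc : 0 ≤ c) (a b : ℝ) : g (c * a) (c * b) = c * g a b := by
  rcases hc.eq_or_lt with rfl | hc
  · simp [hg.zero]
  · exact hg.smul c a b hc

theorem neg_left (a b : ℝ) : g (-a) b = g a b := by
  rw [← hg.abs_abs, abs_neg, hg.abs_abs]

theorem neg_right (a b : ℝ) : g a (-b) = g a b := by
  rw [← hg.abs_abs, abs_neg, hg.abs_abs]

theorem nonneg (a b : ℝ) : 0 ≤ g a b := by
  have h := hg.add_le a b (-a) (-b)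
  rw [add_neg_cancel, add_neg_cancel, hg.zero, hg.neg_left, hg.neg_right] at h
  linarith

theorem apply_zero_right (a : ℝ) : g a 0 = |a| * g 1 0 := by
  rw [← hg.smul_nonneg (abs_nonneg a), mul_one, mul_zero, ← hg.abs_abs, abs_zero]

theorem apply_zero_left (b : ℝ) : g 0 b = |b| * g 0 1 := by
  rw [← hg.smul_nonneg (abs_nonneg b), mul_one, mul_zero, ← hg.abs_abs, abs_zero]

/-- Subadditivity, applied once to the difference vector and once to split it along the axes. This
Lipschitz bound is the source of all continuity below. -/
theorem sub_le (a b a' b' : ℝ) : g a b - g a' b' ≤ |a - a'| * g 1 0 + |b - b'| * g 0 1 := by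
  have h1 := hg.add_le (a - a') (b - b') a' b'
  have h2 := hg.add_le (a - a') 0 0 (b - b')
  rw [hg.apply_zero_right, hg.apply_zero_left] at h2
  simp only [sub_add_cancel, add_zero, zero_add] at h1 h2
  linarith

theorem mono_left {a a' : ℝ} (b : ℝ) (ha : 0 ≤ a) (h : a ≤ a') : g a b ≤ g a' b := by
  rcases (ha.trans h).eq_or_lt with h0 | h0
  · rw [le_antisymm (h0 ▸ h) ha, h0]
  -- With this weight, `(a, b)` is the convex combination of `(a', b')` and `(-a', b')`, two points
  -- at which `g` takes the same value.
  set t := (1 + a / a') / 2 with ht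
  have hd1 : a / a' ≤ 1 := (div_le_one h0).mpr h
  have hd0 : 0 ≤ a / a' := by positivity
  have hda : a / a' * a' = a := div_mul_cancel₀ a h0.ne'
  have h1 := hg.add_le (t * a') (t * b) ((1 - t) * (-a')) ((1 - t) * b)
  rw [hg.smul_nonneg (by linarith), hg.smul_nonneg (by linarith), hg.neg_left] at h1
  have e1 : t * a' + (1 - t) * (-a') = a := by rw [ht]; linarith
  have e2 : t * b + (1 - t) * b = b := by ring
  rw [e1, e2] at h1
  linarith

theorem mono_right (a : ℝ) {b b' : ℝ} (hb : 0 ≤ b) (h : b ≤ b') : g a b ≤ g a b' := by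
  have hswap : IsAbsSeminorm fun a b => g b a :=
    ⟨fun _ _ => hg.abs_abs _ _, fun _ _ _ => hg.smul _ _ _, fun _ _ _ _ => hg.add_le _ _ _ _⟩
  exact hswap.mono_left a hb h

end IsAbsSeminorm

/-- The support function of `op K L` is `g` applied to the support functions of `K` and `L`. -/
def IsGivenBy {n : ℕ} (op : BinOp n) (g : ℝ → ℝ → ℝ) : Prop :=
  ∀ K L x, supportFn (op K L) x = g (supportFn K.1 x) (supportFn L.1 x)

/-! ### Projection covariant operations are given by absolute seminorms -/

theorem exists_unit_orthogonal {n : ℕ} (hn : 2 ≤ n) (u : Eucl n) :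
    ∃ w : Eucl n, ‖w‖ = 1 ∧ inner ℝ u w = 0 := by
  have hlt : Module.finrank ℝ (Submodule.span ℝ {u}) < Module.finrank ℝ (Eucl n) := by
    have : Module.finrank ℝ (Submodule.span ℝ {u}) ≤ 1 := by
      simpa using finrank_span_le_card (R := ℝ) ({u} : Set (Eucl n))
    rw [finrank_euclideanSpace_fin]
    omega
  have hne : (Submodule.span ℝ {u})ᗮ ≠ ⊥ := by
    intro h
    rw [Submodule.orthogonal_eq_bot_iff] at h
    rw [h, finrank_top] at hlt
    exact lt_irrefl _ hlt
  obtain ⟨w, hw, hw0⟩ := Submodule.exists_mem_ne_zero_of_ne_bot hne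
  refine ⟨‖w‖⁻¹ • w, norm_smul_inv_norm hw0, ?_⟩
  rw [real_inner_smul_right, Submodule.mem_orthogonal_singleton_iff_inner_right.mp hw, mul_zero]

/-- The value at `u` of the support function of `op [-su, su] [-tu, tu]`. -/
noncomputable def lineFn {n : ℕ} (op : BinOp n) (u : Eucl n) (s t : ℝ) : ℝ :=
  supportFn (op (symmSegment (s • u)) (symmSegment (t • u))) u

namespace ProjectionCovariant

variable {n : ℕ} {op : BinOp n} (hop : ProjectionCovariant op) (hn : 2 ≤ n)
include hop hn

/-- Projection covariance for the line spanned by `u`, read off on support functions. Here `x` is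
arbitrary, so the result of the operation on segments in this line is known in all directions. -/
theorem supportFn_apply_inner_smul {u : Eucl n} (hu : ‖u‖ = 1) (K L : SymmCompactConvex n)
    (x : Eucl n) :
    supportFn (op K L) (inner ℝ u x • u) =
      supportFn (op (symmSegment (supportFn K.1 u • u)) (symmSegment (supportFn L.1 u • u))) x := by
  have hu0 : u ≠ 0 := by rintro rfl; simp at hu
  have hr := finrank_span_singleton (K := ℝ) hu0
  have h := hop (Submodule.span ℝ {u}) (by omega) (by omega) K L
  rw [mapSymm_starProjection_span_singleton hu, mapSymm_starProjection_span_singleton hu] at h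
  rw [← h, supportFn_mapBody_starProjection, Submodule.starProjection_unit_singleton ℝ hu]

theorem supportFn_eq_lineFn {u : Eucl n} (hu : ‖u‖ = 1) (K L : SymmCompactConvex n) :
    supportFn (op K L) u = lineFn op u (supportFn K.1 u) (supportFn L.1 u) := by
  have h := hop.supportFn_apply_inner_smul hn hu K L u
  rwa [real_inner_self_eq_norm_sq, hu, one_pow, one_smul] at h

/-- The support function at `v` of the operation applied to two segments in the line of `u` is
computed twice: by projecting onto the line of `v`, where the segments shrink by the factor `inner ℝ
u v`, and by projecting onto the line of `u`, which fixes the segments. -/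
theorem lineFn_mul_of_inner {u v : Eucl n} (hu : ‖u‖ = 1) (hv : ‖v‖ = 1) (hc : 0 < inner ℝ u v)
    {s t : ℝ} (hs : 0 ≤ s) (ht : 0 ≤ t) :
    lineFn op v (inner ℝ u v * s) (inner ℝ u v * t) = inner ℝ u v * lineFn op u s t := by
  have hseg : ∀ r : ℝ, 0 ≤ r → ∀ x : Eucl n,
      supportFn (symmSegment (r • u)).1 x = |inner ℝ u x| * r := fun r hr x => by
    rw [supportFn_symmSegment, real_inner_smul_right, abs_mul, abs_of_nonneg hr, real_inner_comm,
      mul_comm]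
  have huu : |inner ℝ u u| = (1 : ℝ) := by rw [real_inner_self_eq_norm_sq, hu]; norm_num
  have h1 := hop.supportFn_eq_lineFn hn hv (symmSegment (s • u)) (symmSegment (t • u))
  have h2 := hop.supportFn_apply_inner_smul hn hu (symmSegment (s • u)) (symmSegment (t • u)) v
  rw [hseg s hs, hseg t ht, huu, one_mul, one_mul, supportFn_smul _ hc] at h2
  rw [hseg s hs, hseg t ht, abs_of_pos hc] at h1
  rw [← h1, ← h2, lineFn]

theorem lineFn_mul {u : Eucl n} (hu : ‖u‖ = 1) {c s t : ℝ} (hc : 0 < c) (hs : 0 ≤ s)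
    (ht : 0 ≤ t) : lineFn op u (c * s) (c * t) = c * lineFn op u s t := by
  have key : ∀ r : ℝ, 0 < r → r ≤ 1 → ∀ s t : ℝ, 0 ≤ s → 0 ≤ t →
      lineFn op u (r * s) (r * t) = r * lineFn op u s t := by
    intro r hr0 hr1 s t hs ht
    obtain ⟨w, hw, huw⟩ := exists_unit_orthogonal hn u
    have huu : inner ℝ u u = (1 : ℝ) := by rw [real_inner_self_eq_norm_sq, hu, one_pow]
    have hww : inner ℝ w w = (1 : ℝ) := by rw [real_inner_self_eq_norm_sq, hw, one_pow]
    -- A unit vector with `inner ℝ u v = √r`: passing from `u` to `v` and back to `u` scales by `√r`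
    -- twice, hence by `r`.
    set v := √r • u + √(1 - r) • w with hv
    have huv : inner ℝ u v = √r := by
      rw [hv, inner_add_right, real_inner_smul_right, real_inner_smul_right, huw, huu]
      ring
    have hv1 : ‖v‖ = 1 := by
      have hsq : ‖v‖ ^ 2 = 1 := by
        rw [← real_inner_self_eq_norm_sq]
        nth_rewrite 1 [hv]
        rw [inner_add_left, real_inner_smul_left, real_inner_smul_left, huv, hv, inner_add_right,
          real_inner_smul_right, real_inner_smul_right, real_inner_comm, huw, hww]
        have e1 := Real.mul_self_sqrt hr0.le
        have e2 := Real.mul_self_sqrt (sub_nonneg.mpr hr1)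
        linear_combination e1 + e2
      nlinarith [norm_nonneg v]
    have hvu : inner ℝ v u = √r := by rw [real_inner_comm, huv]
    have hsr : 0 < √r := Real.sqrt_pos.mpr hr0
    have h1 := hop.lineFn_mul_of_inner hn hu hv1 (by rwa [huv]) hs ht
    have h2 := hop.lineFn_mul_of_inner hn hv1 hu (by rwa [hvu])
      (mul_nonneg hsr.le hs) (mul_nonneg hsr.le ht)
    rw [huv] at h1
    rw [hvu, h1, ← mul_assoc, ← mul_assoc, ← mul_assoc, Real.mul_self_sqrt hr0.le] at h2
    exact h2
  rcases le_total c 1 with h | h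
  · exact key c hc h s t hs ht
  · have h1 := key c⁻¹ (inv_pos.mpr hc) (inv_le_one_of_one_le₀ h) (c * s) (c * t)
      (mul_nonneg hc.le hs) (mul_nonneg hc.le ht)
    rw [inv_mul_cancel_left₀ hc.ne', inv_mul_cancel_left₀ hc.ne'] at h1
    rw [h1, mul_inv_cancel_left₀ hc.ne']

theorem lineFn_eq {u v : Eucl n} (hu : ‖u‖ = 1) (hv : ‖v‖ = 1) {s t : ℝ} (hs : 0 ≤ s)
    (ht : 0 ≤ t) : lineFn op u s t = lineFn op v s t := by
  have hpos : ∀ {u v : Eucl n}, ‖u‖ = 1 → ‖v‖ = 1 → 0 < inner ℝ u v →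
      lineFn op u s t = lineFn op v s t := by
    intro u v hu hv hc
    have h := hop.lineFn_mul_of_inner hn hu hv hc hs ht
    rw [hop.lineFn_mul hn hv hc hs ht] at h
    exact (mul_left_cancel₀ hc.ne' h).symm
  have hne : ∀ {u v : Eucl n}, ‖u‖ = 1 → ‖v‖ = 1 → -1 < inner ℝ u v →
      lineFn op u s t = lineFn op v s t := by
    intro u v hu hv hc
    have huu : inner ℝ u u = (1 : ℝ) := by rw [real_inner_self_eq_norm_sq, hu, one_pow]
    have hvv : inner ℝ v v = (1 : ℝ) := by rw [real_inner_self_eq_norm_sq, hv, one_pow]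
    have h1 : 0 < inner ℝ u (u + v) := by rw [inner_add_right, huu]; linarith
    -- The normalized bisector of `u` and `v` has positive inner product with both.
    have h2 : 0 < inner ℝ (u + v) v := by rw [inner_add_left, hvv]; linarith
    have h0 : u + v ≠ 0 := by
      intro h
      rw [h, inner_zero_right] at h1
      exact lt_irrefl _ h1
    have hp : 0 < ‖u + v‖⁻¹ := inv_pos.mpr (norm_pos_iff.mpr h0)
    have hw : ‖‖u + v‖⁻¹ • (u + v)‖ = 1 := norm_smul_inv_norm h0
    exact (hpos hu hw (by rw [real_inner_smul_right]; positivity)).trans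
      (hpos hw hv (by rw [real_inner_smul_left]; positivity))
  rcases lt_or_ge (-1) (inner ℝ u v) with h | h
  · exact hne hu hv h
  -- Antipodal vectors have no bisector; an orthogonal unit vector serves as the intermediate one.
  · obtain ⟨w, hw, huw⟩ := exists_unit_orthogonal hn u
    have huv : u = -v := by
      rw [← sub_eq_zero, sub_neg_eq_add, ← norm_eq_zero]
      have := norm_add_sq_real u v
      rw [hu, hv] at this
      nlinarith [norm_nonneg (u + v)]
    refine (hne hu hw (by rw [huw]; norm_num)).trans (hne hw hv ?_)
    rw [huv, inner_neg_left] at huw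
    rw [real_inner_comm]
    linarith

theorem exists_isGivenBy : ∃ g, IsAbsSeminorm g ∧ IsGivenBy op g := by
  have hn0 : 0 < n := by omega
  set e : Eucl n := EuclideanSpace.single ⟨0, by omega⟩ 1 with he
  set f : Eucl n := EuclideanSpace.single ⟨1, by omega⟩ 1 with hf
  have he1 : ‖e‖ = 1 := by simp [he]
  have hgiven : IsGivenBy op fun a b => lineFn op e |a| |b| := by
    intro K L x
    simp only [abs_of_nonneg (supportFn_nonneg _ _)]
    have hK := supportFn_nonneg K
    have hL := supportFn_nonneg L
    by_cases hx : x = 0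
    · have h := hop.lineFn_mul hn he1 two_pos le_rfl le_rfl
      rw [mul_zero] at h
      rw [hx, supportFn_zero_right, supportFn_zero_right, supportFn_zero_right]
      linarith
    · have hx0 : 0 < ‖x‖ := norm_pos_iff.mpr hx
      have hu : ‖‖x‖⁻¹ • x‖ = 1 := norm_smul_inv_norm hx
      have hux : x = ‖x‖ • (‖x‖⁻¹ • x) := by
        rw [smul_smul, mul_inv_cancel₀ hx0.ne', one_smul]
      set u := ‖x‖⁻¹ • x with hu'
      rw [hux, supportFn_smul _ hx0, supportFn_smul _ hx0, supportFn_smul _ hx0,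
        hop.lineFn_mul hn he1 hx0 (hK u) (hL u), hop.lineFn_eq hn he1 hu (hK u) (hL u),
        hop.supportFn_eq_lineFn hn hu]
  refine ⟨_, ⟨fun a b => by simp only [abs_abs], fun c a b hc => ?_, fun a b a' b' => ?_⟩, hgiven⟩
  · simp only [abs_mul, abs_of_pos hc]
    exact hop.lineFn_mul hn he1 hc (abs_nonneg a) (abs_nonneg b)
  -- In the plane of `e` and `f`, the segments spanned by `a • e + a' • f` and `b • e + b' • f` have
  -- support values `(|a|, |b|)` at `e`, `(|a'|, |b'|)` at `f`, and `(|a + a'|, |b + b'|)` at `e +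
  -- f`. Subadditivity of one support function is therefore subadditivity of `g`.
  · have hz : ∀ a a' : ℝ, inner ℝ e (a • e + a' • f) = a ∧ inner ℝ f (a • e + a' • f) = a' := by
      intro a a'
      rw [he, hf]
      simp [EuclideanSpace.inner_single_left]
    have h := supportFn_add_le (op (symmSegment (a • e + a' • f)) (symmSegment (b • e + b' • f)))
      e f
    rw [hgiven, hgiven, hgiven] at h
    simpa only [supportFn_symmSegment, inner_add_left, (hz _ _).1, (hz _ _).2, abs_abs] using h

end ProjectionCovariant

/-! ### The Hausdorff metric and support functions -/

theorem supportFn_le_add_dist {n : ℕ} (K L : CompactConvex n) (x : Eucl n) :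
    supportFn K x ≤ supportFn L x + ‖x‖ * dist K L := by
  refine supportFn_le K x fun y hy => ?_
  obtain ⟨z, hz, hyz⟩ := L.isCompact.exists_infDist_eq_dist L.nonempty y
  have h1 : dist y z ≤ dist K L := by
    rw [← hyz, ← ConvexBody.hausdorffDist_coe]
    exact Metric.infDist_le_hausdorffDist_of_mem hy ConvexBody.hausdorffEDist_ne_top
  have h2 : inner ℝ x (y - z) ≤ ‖x‖ * dist K L := by
    refine (real_inner_le_norm _ _).trans ?_
    rw [← dist_eq_norm]
    exact mul_le_mul_of_nonneg_left h1 (norm_nonneg x)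
  rw [inner_sub_right] at h2
  linarith [inner_le_supportFn L x hz]

theorem abs_supportFn_sub_le {n : ℕ} (K L : CompactConvex n) (x : Eucl n) :
    |supportFn K x - supportFn L x| ≤ ‖x‖ * dist K L := by
  have h1 := supportFn_le_add_dist K L x
  have h2 := supportFn_le_add_dist L K x
  rw [dist_comm] at h2
  exact abs_le.mpr ⟨by linarith, by linarith⟩

/-- If `y` is the point of `L` nearest to `x`, then `x - y` is an outer normal of `L` at `y`, so `‖x
- y‖ ^ 2 ≤ h_K(x - y) - h_L(x - y) ≤ ‖x - y‖ * r`. -/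
theorem exists_dist_le_of_supportFn_le {n : ℕ} {K L : CompactConvex n} {r : ℝ} (hr : 0 ≤ r)
    (h : ∀ u : Eucl n, ‖u‖ = 1 → supportFn K u ≤ supportFn L u + r) {x : Eucl n}
    (hx : x ∈ (K : Set (Eucl n))) : ∃ y ∈ (L : Set (Eucl n)), dist x y ≤ r := by
  obtain ⟨y, hy, hmin⟩ :=
    exists_norm_eq_iInf_of_complete_convex L.nonempty L.isClosed.isComplete L.convex x
  rw [norm_eq_iInf_iff_real_inner_le_zero L.convex hy] at hmin
  refine ⟨y, hy, ?_⟩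
  rw [dist_eq_norm]
  by_cases hxy : x - y = 0
  · rwa [hxy, norm_zero]
  have hpos : 0 < ‖x - y‖ := norm_pos_iff.mpr hxy
  have h1 : supportFn L (x - y) ≤ inner ℝ (x - y) y := supportFn_le L _ fun w hw => by
    have := hmin w hw
    rw [inner_sub_right] at this
    linarith
  have h2 := inner_le_supportFn K (x - y) hx
  have h3 := h (‖x - y‖⁻¹ • (x - y)) (norm_smul_inv_norm hxy)
  rw [supportFn_smul _ (inv_pos.mpr hpos), supportFn_smul _ (inv_pos.mpr hpos)] at h3
  have h4 : supportFn K (x - y) ≤ supportFn L (x - y) + ‖x - y‖ * r := by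
    have := mul_le_mul_of_nonneg_left h3 hpos.le
    rwa [mul_add, mul_inv_cancel_left₀ hpos.ne', mul_inv_cancel_left₀ hpos.ne'] at this
  have h5 : ‖x - y‖ * ‖x - y‖ ≤ ‖x - y‖ * r := by
    rw [← real_inner_self_eq_norm_mul_norm, inner_sub_right]
    linarith
  exact le_of_mul_le_mul_left h5 hpos

theorem dist_le_of_abs_supportFn_sub_le {n : ℕ} {K L : CompactConvex n} {r : ℝ} (hr : 0 ≤ r)
    (h : ∀ u : Eucl n, ‖u‖ = 1 → |supportFn K u - supportFn L u| ≤ r) : dist K L ≤ r := by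
  rw [← ConvexBody.hausdorffDist_coe]
  refine Metric.hausdorffDist_le_of_mem_dist hr
    (fun x hx => exists_dist_le_of_supportFn_le hr (fun u hu => ?_) hx)
    (fun x hx => exists_dist_le_of_supportFn_le hr (fun u hu => ?_) hx)
  · linarith [(abs_le.mp (h u hu)).2]
  · linarith [(abs_le.mp (h u hu)).1]

theorem continuous_mapBody {n : ℕ} (K : CompactConvex n) :
    Continuous fun f : Eucl n →L[ℝ] Eucl n => mapBody f K := by
  obtain ⟨C, hC0, hC⟩ := K.isBounded.exists_pos_norm_le
  have hdist : ∀ f f' : Eucl n →L[ℝ] Eucl n, ∀ x ∈ (K : Set (Eucl n)),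
      dist (f x) (f' x) ≤ dist f f' * C := by
    intro f f' x hx
    rw [dist_eq_norm, dist_eq_norm, ← sub_apply]
    exact ((f - f').le_opNorm x).trans (mul_le_mul_of_nonneg_left (hC x hx) (norm_nonneg _))
  refine (LipschitzWith.of_dist_le_mul (K := C.toNNReal) fun f f' => ?_).continuous
  rw [← ConvexBody.hausdorffDist_coe, Real.coe_toNNReal C hC0.le, mul_comm]
  refine Metric.hausdorffDist_le_of_mem_dist (by positivity) ?_ ?_
  · rintro _ ⟨x, hx, rfl⟩
    exact ⟨f' x, ⟨x, hx, rfl⟩, hdist f f' x hx⟩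
  · rintro _ ⟨x, hx, rfl⟩
    refine ⟨f x, ⟨x, hx, rfl⟩, ?_⟩
    rw [dist_comm f f']
    exact hdist f' f x hx

theorem continuous_mapSymm {n : ℕ} (K : SymmCompactConvex n) :
    Continuous fun f : Eucl n →L[ℝ] Eucl n => mapSymm f K :=
  (continuous_mapBody K.1).subtype_mk _

/-! ### Covariance and continuity of operations given by absolute seminorms -/

namespace IsGivenBy

variable {n : ℕ} {op : BinOp n} {g : ℝ → ℝ → ℝ} (h : IsGivenBy op g)
include h

theorem projectionCovariant : ProjectionCovariant op := fun S _ _ K L =>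
  eq_of_supportFn_eq fun x => by
    rw [supportFn_mapBody_starProjection, h, h]
    simp only [mapSymm, supportFn_mapBody_starProjection]

theorem glCovariant : GLCovariant op := fun φ K L => eq_of_supportFn_eq fun x => by
  rw [supportFn_mapBody, h, h]
  simp only [mapSymm, supportFn_mapBody]

theorem isOSymm (K L : SymmCompactConvex n) : IsOSymm (op K L : Set (Eucl n)) :=
  isOSymm_of_supportFn_neg fun x => by rw [h, h, supportFn_neg, supportFn_neg]

theorem dist_le (hg : IsAbsSeminorm g) (K L K' L' : SymmCompactConvex n) :
    dist (op K L) (op K' L') ≤ dist K K' * g 1 0 + dist L L' * g 0 1 := by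
  have h10 := hg.nonneg 1 0
  have h01 := hg.nonneg 0 1
  refine dist_le_of_abs_supportFn_sub_le (by positivity) fun u hu => ?_
  have key : ∀ N N' : SymmCompactConvex n, |supportFn N.1 u - supportFn N'.1 u| ≤ dist N N' :=
    fun N N' => by
      have := abs_supportFn_sub_le N.1 N'.1 u
      rwa [hu, one_mul] at this
  have hle : |supportFn K.1 u - supportFn K'.1 u| * g 1 0 +
      |supportFn L.1 u - supportFn L'.1 u| * g 0 1 ≤ dist K K' * g 1 0 + dist L L' * g 0 1 :=
    add_le_add (mul_le_mul_of_nonneg_right (key K K') h10)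
      (mul_le_mul_of_nonneg_right (key L L') h01)
  rw [h, h]
  refine (abs_sub_le_iff.mpr ⟨hg.sub_le _ _ _ _, ?_⟩).trans hle
  rw [abs_sub_comm (supportFn K.1 u), abs_sub_comm (supportFn L.1 u)]
  exact hg.sub_le _ _ _ _

theorem hausdorffContinuous (hg : IsAbsSeminorm g) : HausdorffContinuous op := by
  refine continuous_iff_continuousAt.mpr fun P => ?_
  refine tendsto_iff_dist_tendsto_zero.mpr (squeeze_zero (fun _ => dist_nonneg)
    (fun Q => h.dist_le hg Q.1 Q.2 P.1 P.2) ?_)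
  have hc : Continuous fun Q : SymmCompactConvex n × SymmCompactConvex n =>
      dist Q.1 P.1 * g 1 0 + dist Q.2 P.2 * g 0 1 := by fun_prop
  simpa using hc.tendsto P

end IsGivenBy

theorem projectionCovariant_of_continuous_of_gl {n : ℕ} {op : BinOp n}
    (hc : HausdorffContinuous op) (hgl : GLCovariant op) : ProjectionCovariant op := by
  intro S _ _ K L
  -- The identity on `S` and multiplication by `r` on the orthogonal complement: invertible for `r ≠
  -- 0`, with inverse `φ r⁻¹`, and equal to the projection at `r = 0`.
  set φ : ℝ → (Eucl n →L[ℝ] Eucl n) := fun r =>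
    S.starProjection + r • (ContinuousLinearMap.id ℝ (Eucl n) - S.starProjection) with hφ
  have hφc : Continuous φ := by fun_prop
  have hφa : ∀ r x, φ r x = S.starProjection x + r • (x - S.starProjection x) := fun _ _ => rfl
  have hφ0 : φ 0 = S.starProjection := ContinuousLinearMap.ext fun x => by
    rw [hφa, zero_smul, add_zero]
  have hmul : ∀ r s : ℝ, r * s = 1 → ∀ x, φ r (φ s x) = x := by
    intro r s hrs x
    have hid : S.starProjection (S.starProjection x) = S.starProjection x :=
      Submodule.starProjection_eq_self_iff.mpr (Submodule.starProjection_apply_mem S x)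
    have hproj : S.starProjection (φ s x) = S.starProjection x := by
      rw [hφa, map_add, map_smul, map_sub, hid, sub_self, smul_zero, add_zero]
    rw [hφa r, hproj, hφa, add_sub_cancel_left, smul_smul, hrs, one_smul, add_sub_cancel]
  have hcov : ∀ r : ℝ, r ≠ 0 →
      mapBody (φ r) (op K L) = op (mapSymm (φ r) K) (mapSymm (φ r) L) := fun r hr =>
    hgl (ContinuousLinearEquiv.equivOfInverse (φ r) (φ r⁻¹) (hmul _ _ (inv_mul_cancel₀ hr))
      (hmul _ _ (mul_inv_cancel₀ hr))) K L
  have h1 : Continuous fun r => mapBody (φ r) (op K L) := (continuous_mapBody _).comp hφc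
  have h2 : Continuous fun r => op (mapSymm (φ r) K) (mapSymm (φ r) L) :=
    hc.comp (((continuous_mapSymm K).comp hφc).prodMk ((continuous_mapSymm L).comp hφc))
  have heq := h1.ext_on (dense_compl_singleton (0 : ℝ)) h2 fun r hr => hcov r hr
  have := congrFun heq 0
  rwa [hφ0] at this

/-! ### Associative absolute seminorms on the plane -/

/-- A monotone completely multiplicative function on `ℕ` with values at least `1` is a power. -/
theorem eq_rpow_of_monotone_of_mul {f : ℕ → ℝ} (hmono : Monotone f)
    (hmul : ∀ m k, f (m * k) = f m * f k) (hone : ∀ k, 1 ≤ k → 1 ≤ f k) {m : ℕ} (hm : 1 ≤ m) :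
    f m = (m : ℝ) ^ (Real.log (f 2) / Real.log 2) := by
  have hpow : ∀ a : ℕ, 1 ≤ a → ∀ k : ℕ, Real.log (f (a ^ k)) = k * Real.log (f a) := by
    intro a ha k
    have h1 : f 1 = 1 := by
      have h := hmul 1 1
      have h0 := hone 1 le_rfl
      rw [one_mul] at h
      exact mul_left_cancel₀ (by linarith) (h.symm.trans (mul_one _).symm)
    have : f (a ^ k) = f a ^ k := by
      induction k with
      | zero => rw [pow_zero, pow_zero, h1]
      | succ k ih => rw [pow_succ, hmul, ih, pow_succ]
    rw [this, Real.log_pow]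
  have hlogmono : ∀ a b : ℕ, 1 ≤ a → a ≤ b → Real.log (f a) ≤ Real.log (f b) := fun a b ha hab =>
    Real.log_le_log (by linarith [hone a ha]) (hmono hab)
  have hd : 0 < Real.log 2 := Real.log_pos one_lt_two
  have hB : 0 ≤ Real.log (f 2) := Real.log_nonneg (hone 2 one_le_two)
  -- Squeezing `m ^ k` between consecutive powers of `2` locates both `log (m ^ k)` and `log (f (m ^
  -- k))` up to one step. The bound does not depend on `k`, so the quantity multiplied by `k` must
  -- vanish.
  have hbound : ∀ k : ℕ, k * |Real.log (f m) * Real.log 2 - Real.log (f 2) * Real.log m| ≤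
      Real.log (f 2) * Real.log 2 := by
    intro k
    have hmk : 1 ≤ m ^ k := Nat.one_le_pow _ _ hm
    set j := Nat.log 2 (m ^ k)
    have hj1 : 2 ^ j ≤ m ^ k := Nat.pow_log_le_self 2 (by omega)
    have hj2 : m ^ k ≤ 2 ^ (j + 1) := (Nat.lt_pow_succ_log_self one_lt_two _).le
    have h1 := hlogmono _ _ Nat.one_le_two_pow hj1
    have h2 := hlogmono _ _ hmk hj2
    rw [hpow m hm, hpow 2 one_le_two] at h1 h2
    have h3 : Real.log ((2 : ℝ) ^ j) ≤ Real.log ((m : ℝ) ^ k) :=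
      Real.log_le_log (by positivity) (by exact_mod_cast hj1)
    have h4 : Real.log ((m : ℝ) ^ k) ≤ Real.log ((2 : ℝ) ^ (j + 1)) :=
      Real.log_le_log (by exact_mod_cast hmk) (by exact_mod_cast hj2)
    rw [Real.log_pow, Real.log_pow] at h3 h4
    push_cast at h2 h4
    rw [← abs_of_nonneg (Nat.cast_nonneg (α := ℝ) k), ← abs_mul]
    refine abs_le.mpr ⟨?_, ?_⟩
    · nlinarith [mul_le_mul_of_nonneg_right h1 hd.le, mul_le_mul_of_nonneg_right h4 hB]
    · nlinarith [mul_le_mul_of_nonneg_right h2 hd.le, mul_le_mul_of_nonneg_right h3 hB]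
  have hzero : Real.log (f m) * Real.log 2 - Real.log (f 2) * Real.log m = 0 := by
    by_contra hne
    have hpos := abs_pos.mpr hne
    obtain ⟨k, hk⟩ := exists_nat_gt
      (Real.log (f 2) * Real.log 2 / |Real.log (f m) * Real.log 2 - Real.log (f 2) * Real.log m|)
    rw [div_lt_iff₀ hpos] at hk
    exact absurd (hbound k) (not_le.mpr hk)
  have hm0 : (0 : ℝ) < m := by exact_mod_cast hm
  rw [Real.rpow_def_of_pos hm0, ← Real.exp_log (by linarith [hone m hm] : 0 < f m)]
  congr 1
  field_simp
  linarith

/-- Associativity of `g` on the nonnegative reals. -/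
def IsAssocOnNonneg (g : ℝ → ℝ → ℝ) : Prop :=
  ∀ a b c, 0 ≤ a → 0 ≤ b → 0 ≤ c → g a (g b c) = g (g a b) c

/-- The iterates `1 * ⋯ * 1` under the operation `g`. -/
def iterOne (g : ℝ → ℝ → ℝ) : ℕ → ℝ
  | 0 => 0
  | k + 1 => g (iterOne g k) 1

namespace IsAbsSeminorm

variable {g : ℝ → ℝ → ℝ} (hg : IsAbsSeminorm g)
include hg

theorem continuous : Continuous fun P : ℝ × ℝ => g P.1 P.2 := by
  refine continuous_iff_continuousAt.mpr fun P => tendsto_iff_dist_tendsto_zero.mpr ?_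
  refine squeeze_zero (fun _ => dist_nonneg)
    (g := fun Q : ℝ × ℝ => |Q.1 - P.1| * g 1 0 + |Q.2 - P.2| * g 0 1) (fun Q => ?_) ?_
  · refine abs_sub_le_iff.mpr ⟨hg.sub_le _ _ _ _, ?_⟩
    rw [abs_sub_comm Q.1, abs_sub_comm Q.2]
    exact hg.sub_le _ _ _ _
  · have hc : Continuous fun Q : ℝ × ℝ => |Q.1 - P.1| * g 1 0 + |Q.2 - P.2| * g 0 1 := by fun_prop
    simpa using hc.tendsto P

theorem eq_left_of_apply_zero_one (h : g 0 1 = 0) (a b : ℝ) : g a b = |a| * g 1 0 := by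
  have h1 := hg.sub_le a b a 0
  have h2 := hg.sub_le a 0 a b
  rw [hg.apply_zero_right, h] at h1 h2
  simp only [sub_self, abs_zero, zero_mul, mul_zero, add_zero] at h1 h2
  linarith

theorem eq_right_of_apply_one_zero (h : g 1 0 = 0) (a b : ℝ) : g a b = |b| * g 0 1 := by
  have h1 := hg.sub_le a b 0 b
  have h2 := hg.sub_le 0 b a b
  rw [hg.apply_zero_left, h] at h1 h2
  simp only [sub_self, abs_zero, zero_mul, mul_zero, add_zero] at h1 h2
  linarith

theorem iterOne_nonneg (k : ℕ) : 0 ≤ iterOne g k := by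
  cases k with
  | zero => exact le_rfl
  | succ k => exact hg.nonneg _ _

theorem iterOne_add (ha : IsAssocOnNonneg g) (h10 : g 1 0 = 1) (m k : ℕ) :
    iterOne g (m + k) = g (iterOne g m) (iterOne g k) := by
  induction k with
  | zero =>
    rw [add_zero, iterOne, hg.apply_zero_right, h10, mul_one, abs_of_nonneg (hg.iterOne_nonneg m)]
  | succ k ih =>
    rw [← add_assoc, iterOne, ih, iterOne,
      ha _ _ _ (hg.iterOne_nonneg m) (hg.iterOne_nonneg k) zero_le_one]

/-- By homogeneity, multiplying the recursion for `k + 1` by `iterOne g m` combines the iterate of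
order `m * k` with that of order `m`, and additivity of the index applies. -/
theorem iterOne_mul (ha : IsAssocOnNonneg g) (h10 : g 1 0 = 1) (m k : ℕ) :
    iterOne g (m * k) = iterOne g m * iterOne g k := by
  induction k with
  | zero => rw [mul_zero, iterOne, mul_zero]
  | succ k ih =>
    rw [Nat.mul_succ, hg.iterOne_add ha h10, ih, iterOne, ← hg.smul_nonneg (hg.iterOne_nonneg m),
      mul_one]

theorem iterOne_monotone (h10 : g 1 0 = 1) : Monotone (iterOne g) := by
  refine monotone_nat_of_le_succ fun k => ?_
  have h := hg.mono_right (iterOne g k) le_rfl zero_le_one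
  rwa [hg.apply_zero_right, h10, mul_one, abs_of_nonneg (hg.iterOne_nonneg k)] at h

theorem eq_max (h10 : g 1 0 = 1) (h01 : g 0 1 = 1) (h11 : g 1 1 = 1) {a b : ℝ} (ha : 0 ≤ a)
    (hb : 0 ≤ b) : g a b = max a b := by
  refine le_antisymm ?_ (max_le ?_ ?_)
  · have hm : 0 ≤ max a b := le_max_of_le_left ha
    refine ((hg.mono_left b ha (le_max_left a b)).trans
      (hg.mono_right _ hb (le_max_right a b))).trans_eq ?_
    have h := hg.smul_nonneg hm 1 1
    rwa [mul_one, h11, mul_one] at h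
  · have h := hg.mono_right a le_rfl hb
    rwa [hg.apply_zero_right, h10, mul_one, abs_of_nonneg ha] at h
  · have h := hg.mono_left b le_rfl ha
    rwa [hg.apply_zero_left, h01, mul_one, abs_of_nonneg hb] at h

/-- Homogeneity clears a common denominator, which gives the rationals; the approximations `⌊x * N⌋
/ N` and continuity give the reals. -/
theorem apply_rpow_rpow {r : ℝ} (hr : 0 < r)
    (hnat : ∀ m k : ℕ, g ((m : ℝ) ^ r) ((k : ℝ) ^ r) = ((m : ℝ) + k) ^ r) {x y : ℝ}
    (hx : 0 ≤ x) (hy : 0 ≤ y) : g (x ^ r) (y ^ r) = (x + y) ^ r := by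
  have hrat : ∀ m k N : ℕ, 0 < N →
      g (((m : ℝ) / N) ^ r) (((k : ℝ) / N) ^ r) = ((m : ℝ) / N + (k : ℝ) / N) ^ r := by
    intro m k N hN
    have hN' : (0 : ℝ) < (N : ℝ) ^ r := Real.rpow_pos_of_pos (by exact_mod_cast hN) r
    have h := hg.smul ((N : ℝ) ^ r) (((m : ℝ) / N) ^ r) (((k : ℝ) / N) ^ r) hN'
    have hc : ∀ z : ℝ, 0 ≤ z → (N : ℝ) ^ r * (z / N) ^ r = z ^ r := fun z hz => by
      rw [← Real.mul_rpow (by positivity) (by positivity), mul_div_cancel₀ z (by positivity)]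
    rw [hc _ (by positivity), hc _ (by positivity), hnat] at h
    rw [← add_div]
    apply mul_left_cancel₀ hN'.ne'
    rw [← h, hc _ (by positivity)]
  have hrpow : Continuous fun z : ℝ => z ^ r := Real.continuous_rpow_const hr.le
  have hlx := (tendsto_nat_floor_mul_div_atTop hx).comp tendsto_natCast_atTop_atTop (α := ℕ)
  have hly := (tendsto_nat_floor_mul_div_atTop hy).comp tendsto_natCast_atTop_atTop (α := ℕ)
  have h1 := (hg.continuous.tendsto (x ^ r, y ^ r)).comp
    (((hrpow.tendsto x).comp hlx).prodMk_nhds ((hrpow.tendsto y).comp hly))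
  have h2 := (hrpow.tendsto (x + y)).comp (hlx.add hly)
  refine tendsto_nhds_unique h1 (h2.congr' ?_)
  filter_upwards [Filter.eventually_gt_atTop 0] with N hN
  exact (hrat _ _ N hN).symm

theorem exists_eq_lpCombine (ha : IsAssocOnNonneg g) (h10 : g 1 0 = 1) (h01 : g 0 1 = 1) :
    ∃ p : ℝ≥0∞, 1 ≤ p ∧ ∀ a b, 0 ≤ a → 0 ≤ b → g a b = lpCombine p a b := by
  have hi1 : iterOne g 1 = 1 := h01
  have hi2 : iterOne g 2 = g 1 1 := by change g (iterOne g 1) 1 = _; rw [hi1]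
  have hmono := hg.iterOne_monotone h10
  have hone : ∀ k, 1 ≤ k → 1 ≤ iterOne g k := fun k hk => hi1 ▸ hmono hk
  have hpow := fun {m : ℕ} => eq_rpow_of_monotone_of_mul (m := m) hmono (hg.iterOne_mul ha h10) hone
  by_cases h11 : g 1 1 = 1
  · refine ⟨∞, le_top, fun a b ha hb => ?_⟩
    rw [lpCombine, if_pos rfl, hg.eq_max h10 h01 h11 ha hb]
  have hgt : 1 < g 1 1 := lt_of_le_of_ne (hi2 ▸ hone 2 one_le_two) (Ne.symm h11)
  have hle : g 1 1 ≤ 2 := by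
    have h := hg.add_le 1 0 0 1
    rw [h10, h01, add_zero, zero_add] at h
    linarith
  -- The exponent is `log₂ g(1,1)`. It lies in `(0, 1]` because `1 < g(1,1) ≤ g(1,0) + g(0,1) = 2`,
  -- so that `p = 1 / r ≥ 1`.
  set r := Real.log (iterOne g 2) / Real.log 2 with hr
  have hlog2 : 0 < Real.log 2 := Real.log_pos one_lt_two
  have hr0 : 0 < r := div_pos (by rw [hi2]; exact Real.log_pos hgt) hlog2
  have hr1 : r ≤ 1 :=
    (div_le_one hlog2).mpr (by rw [hi2]; exact Real.log_le_log (by linarith) hle)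
  have hnat' : ∀ m : ℕ, iterOne g m = (m : ℝ) ^ r := by
    intro m
    rcases Nat.eq_zero_or_pos m with rfl | hm
    · rw [iterOne, Nat.cast_zero, Real.zero_rpow hr0.ne']
    · exact hpow hm
  have hreal := fun {x y : ℝ} => hg.apply_rpow_rpow (x := x) (y := y) hr0 fun m k => by
    rw [← hnat', ← hnat', ← hg.iterOne_add ha h10, hnat', Nat.cast_add]
  have hp1 : 1 ≤ 1 / r := (one_le_div hr0).mpr hr1
  refine ⟨ENNReal.ofReal (1 / r), ?_, fun a b ha hb => ?_⟩
  · rw [← ENNReal.ofReal_one]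
    exact ENNReal.ofReal_le_ofReal hp1
  · have hinv : ∀ z : ℝ, 0 ≤ z → (z ^ (1 / r)) ^ r = z := fun z hz => by
      rw [← Real.rpow_mul hz, one_div_mul_cancel hr0.ne', Real.rpow_one]
    have h := hreal (Real.rpow_nonneg ha (1 / r)) (Real.rpow_nonneg hb (1 / r))
    rw [hinv a ha, hinv b hb] at h
    rw [lpCombine, if_neg ENNReal.ofReal_ne_top, ENNReal.toReal_ofReal (by linarith), h,
      one_div_one_div]

theorem classification_of_assoc (ha : IsAssocOnNonneg g) :
    (∀ a b, g a b = 0) ∨ (∀ a b, g a b = |a|) ∨ (∀ a b, g a b = |b|) ∨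
      ∃ p : ℝ≥0∞, 1 ≤ p ∧ ∀ a b, 0 ≤ a → 0 ≤ b → g a b = lpCombine p a b := by
  have h10 : g 1 0 = 0 ∨ g 1 0 = 1 := by
    -- This instance of associativity says that `g(1,0)` equals its own square.
    have h := ha 1 0 0 zero_le_one le_rfl le_rfl
    rw [hg.zero, hg.apply_zero_right (g 1 0), abs_of_nonneg (hg.nonneg _ _)] at h
    have : g 1 0 * (g 1 0 - 1) = 0 := by linarith
    exact (mul_eq_zero.mp this).imp_right sub_eq_zero.mp
  have h01 : g 0 1 = 0 ∨ g 0 1 = 1 := by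
    have h := ha 0 0 1 le_rfl le_rfl zero_le_one
    rw [hg.zero, hg.apply_zero_left (g 0 1), abs_of_nonneg (hg.nonneg _ _)] at h
    have : g 0 1 * (g 0 1 - 1) = 0 := by linarith
    exact (mul_eq_zero.mp this).imp_right sub_eq_zero.mp
  rcases h10 with h10 | h10 <;> rcases h01 with h01 | h01
  · exact Or.inl fun a b => by rw [hg.eq_left_of_apply_zero_one h01, h10, mul_zero]
  · exact Or.inr <| Or.inr <| Or.inl fun a b => by
      rw [hg.eq_right_of_apply_one_zero h10, h01, mul_one]
  · exact Or.inr <| Or.inl fun a b => by rw [hg.eq_left_of_apply_zero_one h01, h10, mul_one]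
  · exact Or.inr <| Or.inr <| Or.inr <| hg.exists_eq_lpCombine ha h10 h01

end IsAbsSeminorm

/-! ### The `ℓₚ` norms on the plane -/

theorem norm_toLp_eq_lpCombine {p : ℝ≥0∞} (hp : 1 ≤ p) (a b : ℝ) :
    ‖WithLp.toLp p (a, b)‖ = lpCombine p |a| |b| := by
  unfold lpCombine
  split_ifs with h
  · subst h
    rw [WithLp.prod_norm_eq_sup]
    simp
  · rw [WithLp.prod_norm_eq_add
      (ENNReal.toReal_pos (zero_lt_one.trans_le hp).ne' h)]
    simp

theorem isAbsSeminorm_lp {p : ℝ≥0∞} (hp : 1 ≤ p) :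
    IsAbsSeminorm fun a b => ‖WithLp.toLp p (a, b)‖ := by
  have : Fact (1 ≤ p) := ⟨hp⟩
  refine ⟨fun a b => ?_, fun c a b hc => ?_, fun a b a' b' => ?_⟩
  · simp only [norm_toLp_eq_lpCombine hp, abs_abs]
  · have h := norm_smul c (WithLp.toLp p (a, b))
    rw [Real.norm_of_nonneg hc.le] at h
    exact h
  · exact norm_add_le (WithLp.toLp p (a, b)) (WithLp.toLp p (a', b'))

theorem lpCombine_zero_right {p : ℝ≥0∞} (hp : 1 ≤ p) {a : ℝ} (ha : 0 ≤ a) :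
    lpCombine p a 0 = a := by
  unfold lpCombine
  split_ifs with h
  · exact max_eq_left ha
  · have h0 : p.toReal ≠ 0 := (ENNReal.toReal_pos (zero_lt_one.trans_le hp).ne' h).ne'
    rw [Real.zero_rpow h0, add_zero, ← Real.rpow_mul ha, mul_one_div_cancel h0, Real.rpow_one]

theorem lpCombine_comm (p : ℝ≥0∞) (a b : ℝ) : lpCombine p a b = lpCombine p b a := by
  unfold lpCombine
  rw [max_comm, add_comm]

theorem lpCombine_zero_left {p : ℝ≥0∞} (hp : 1 ≤ p) {b : ℝ} (hb : 0 ≤ b) :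
    lpCombine p 0 b = b := by
  rw [lpCombine_comm, lpCombine_zero_right hp hb]

theorem lpCombine_assoc {p : ℝ≥0∞} (hp : 1 ≤ p) {a b c : ℝ} (ha : 0 ≤ a) (hb : 0 ≤ b)
    (hc : 0 ≤ c) : lpCombine p a (lpCombine p b c) = lpCombine p (lpCombine p a b) c := by
  unfold lpCombine
  split_ifs with h
  · exact (max_assoc a b c).symm
  · have h0 : p.toReal ≠ 0 := (ENNReal.toReal_pos (zero_lt_one.trans_le hp).ne' h).ne'
    have hinv : ∀ z : ℝ, 0 ≤ z → (z ^ (1 / p.toReal)) ^ p.toReal = z := fun z hz => by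
      rw [← Real.rpow_mul hz, one_div_mul_cancel h0, Real.rpow_one]
    rw [hinv _ (by positivity), hinv _ (by positivity), add_assoc]

theorem isAssocOnNonneg_lp {p : ℝ≥0∞} (hp : 1 ≤ p) :
    IsAssocOnNonneg fun a b => ‖WithLp.toLp p (a, b)‖ := by
  intro a b c ha hb hc
  simp only
  rw [← lpCombine_eq_norm hp hb hc, ← lpCombine_eq_norm hp ha hb,
    ← lpCombine_eq_norm hp ha, ← lpCombine_eq_norm hp _ hc, lpCombine_assoc hp ha hb hc]
  · rw [lpCombine_eq_norm hp ha hb]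
    exact (isAbsSeminorm_lp hp).nonneg a b
  · rw [lpCombine_eq_norm hp hb hc]
    exact (isAbsSeminorm_lp hp).nonneg b c

theorem isGivenBy_lpAdd {n : ℕ} {p : ℝ≥0∞} (hp : 1 ≤ p) :
    IsGivenBy (lpAdd p hp : BinOp n) fun a b => ‖WithLp.toLp p (a, b)‖ := fun K L x => by
  rw [supportFn_lpAdd, lpCombine_eq_norm hp (supportFn_nonneg K x) (supportFn_nonneg L x)]

/-! ### The classification in terms of `Lₚ` addition -/

theorem IsGivenBy.associative {n : ℕ} {op : BinOp n} {g : ℝ → ℝ → ℝ} (h : IsGivenBy op g)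
    (ha : IsAssocOnNonneg g) : Associative op := fun K L N hLN hKL =>
  eq_of_supportFn_eq fun x => by
    rw [h, h, h, h]
    exact ha _ _ _ (supportFn_nonneg K x) (supportFn_nonneg L x) (supportFn_nonneg N x)

theorem supportFn_smul_symmSegment_self {n : ℕ} {e : Eucl n} (he : ‖e‖ = 1) {a : ℝ} (ha : 0 ≤ a) :
    supportFn (symmSegment (a • e)).1 e = a := by
  rw [supportFn_symmSegment, real_inner_smul_right, real_inner_self_eq_norm_sq, he, one_pow,
    mul_one, abs_of_nonneg ha]

theorem exists_norm_eq_one {n : ℕ} (hn : 0 < n) : ∃ e : Eucl n, ‖e‖ = 1 :=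
  ⟨EuclideanSpace.single ⟨0, hn⟩ 1, by simp⟩

/-- Every triple of nonnegative numbers occurs as the support values of three parallel segments at a
unit vector. -/
theorem IsGivenBy.isAssocOnNonneg {n : ℕ} {op : BinOp n} {g : ℝ → ℝ → ℝ} (h : IsGivenBy op g)
    (hn : 0 < n) (ha : Associative op) : IsAssocOnNonneg g := by
  intro a b c h0a h0b h0c
  obtain ⟨e, he⟩ := exists_norm_eq_one hn
  have hK := congrArg (fun N => supportFn N e)
    (ha (symmSegment (a • e)) (symmSegment (b • e)) (symmSegment (c • e)) (h.isOSymm _ _)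
      (h.isOSymm _ _))
  rw [h, h, h, h] at hK
  simpa only [supportFn_smul_symmSegment_self he, h0a, h0b, h0c] using hK

theorem supportFn_originSymm {n : ℕ} (x : Eucl n) : supportFn (originSymm n).1 x = 0 := by
  refine le_antisymm (supportFn_le _ x fun y hy => ?_) (supportFn_nonneg _ x)
  have : y = 0 := hy
  rw [this, inner_zero_right]

theorem coe_eq_singleton_zero_iff {n : ℕ} (K : CompactConvex n) :
    (K : Set (Eucl n)) = {0} ↔ K = (originSymm n).1 :=
  ⟨fun h => ConvexBody.ext h, fun h => by rw [h]; rfl⟩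

theorem projectionCovariant_and_associative_iff {n : ℕ} (hn : 2 ≤ n) (op : BinOp n) :
    ProjectionCovariant op ∧ Associative op ↔
      (∀ K L, (op K L : Set (Eucl n)) = {0}) ∨ (∀ K L, op K L = K.1) ∨ (∀ K L, op K L = L.1) ∨
      ∃ (p : ℝ≥0∞) (hp : 1 ≤ p), op = lpAdd p hp := by
  simp only [coe_eq_singleton_zero_iff]
  constructor
  · rintro ⟨hop, ha⟩
    obtain ⟨g, hg, h⟩ := hop.exists_isGivenBy hn
    rcases hg.classification_of_assoc (h.isAssocOnNonneg (by omega) ha) with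
      h0 | h0 | h0 | ⟨p, hp, h0⟩
    · exact Or.inl fun K L => eq_of_supportFn_eq fun x => by rw [h, h0, supportFn_originSymm]
    · exact Or.inr <| Or.inl fun K L => eq_of_supportFn_eq fun x => by
        rw [h, h0, abs_of_nonneg (supportFn_nonneg K x)]
    · exact Or.inr <| Or.inr <| Or.inl fun K L => eq_of_supportFn_eq fun x => by
        rw [h, h0, abs_of_nonneg (supportFn_nonneg L x)]
    · refine Or.inr <| Or.inr <| Or.inr ⟨p, hp, funext fun K => funext fun L =>
        eq_of_supportFn_eq fun x => ?_⟩
      rw [h, h0 _ _ (supportFn_nonneg K x) (supportFn_nonneg L x), supportFn_lpAdd]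
  -- No seminorm property is needed in this direction, so the plain coordinate functions may serve
  -- as `g`.
  · have key : ∀ g : ℝ → ℝ → ℝ, IsGivenBy op g → IsAssocOnNonneg g →
        ProjectionCovariant op ∧ Associative op := fun g h ha =>
      ⟨h.projectionCovariant, h.associative ha⟩
    rintro (h | h | h | ⟨p, hp, rfl⟩)
    · exact key (fun _ _ => 0) (fun K L x => by rw [h, supportFn_originSymm])
        fun _ _ _ _ _ _ => rfl
    · exact key (fun a _ => a) (fun K L x => by rw [h]) fun _ _ _ _ _ _ => rfl
    · exact key (fun _ b => b) (fun K L x => by rw [h]) fun _ _ _ _ _ _ => rfl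
    · exact key _ (isGivenBy_lpAdd hp) (isAssocOnNonneg_lp hp)

theorem hasIdentity_lpAdd {n : ℕ} {p : ℝ≥0∞} (hp : 1 ≤ p) :
    HasIdentity (lpAdd p hp : BinOp n) := fun K => by
  refine ⟨eq_of_supportFn_eq fun x => ?_, eq_of_supportFn_eq fun x => ?_⟩
  · rw [supportFn_lpAdd, supportFn_originSymm, lpCombine_zero_right hp (supportFn_nonneg K x)]
  · rw [supportFn_lpAdd, supportFn_originSymm, lpCombine_zero_left hp (supportFn_nonneg K x)]

theorem exists_ne_originSymm {n : ℕ} (hn : 0 < n) :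
    ∃ K : SymmCompactConvex n, K.1 ≠ (originSymm n).1 := by
  obtain ⟨e, he⟩ := exists_norm_eq_one hn
  refine ⟨symmSegment ((1 : ℝ) • e), fun h => ?_⟩
  have h1 := supportFn_smul_symmSegment_self he zero_le_one
  rw [h, supportFn_originSymm] at h1
  exact zero_ne_one h1

theorem projectionCovariant_and_associative_and_hasIdentity_iff {n : ℕ} (hn : 2 ≤ n)
    (op : BinOp n) : ProjectionCovariant op ∧ Associative op ∧ HasIdentity op ↔
      ∃ (p : ℝ≥0∞) (hp : 1 ≤ p), op = lpAdd p hp := by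
  rw [← and_assoc, projectionCovariant_and_associative_iff hn]
  constructor
  · rintro ⟨h, hid⟩
    obtain ⟨K, hK⟩ := exists_ne_originSymm (n := n) (by omega)
    simp only [coe_eq_singleton_zero_iff] at h
    rcases h with h | h | h | h
    · exact absurd ((hid K).1.symm.trans (h _ _)) hK
    · exact absurd ((hid K).2.symm.trans (h _ _)) hK
    · exact absurd ((hid K).1.symm.trans (h _ _)) hK
    · exact h
  · rintro ⟨p, hp, rfl⟩
    exact ⟨Or.inr <| Or.inr <| Or.inr ⟨p, hp, rfl⟩, hasIdentity_lpAdd hp⟩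

theorem projectionCovariant_iff {n : ℕ} (hn : 2 ≤ n) (op : BinOp n) :
    ProjectionCovariant op ↔ HausdorffContinuous op ∧ GLCovariant op := by
  refine ⟨fun hop => ?_, fun h => projectionCovariant_of_continuous_of_gl h.1 h.2⟩
  obtain ⟨g, hg, h⟩ := hop.exists_isGivenBy hn
  exact ⟨h.hausdorffContinuous hg, h.glCovariant⟩

/-! ### `M`-addition for the unit balls of the `ℓₚ` norms -/

theorem exists_holderConjugate {p : ℝ≥0∞} (hp : 1 ≤ p) :
    ∃ q : ℝ≥0∞, 1 ≤ q ∧ ENNReal.HolderConjugate p q := by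
  -- The conventions `0⁻¹ = ∞` and `∞⁻¹ = 0` make this formula cover `p = 1` and `p = ∞` as well.
  have h : ENNReal.HolderConjugate p (1 - p⁻¹)⁻¹ := by
    rw [ENNReal.holderConjugate_iff, inv_inv]
    exact add_tsub_cancel_of_le (ENNReal.inv_le_one.mpr hp)
  exact ⟨_, have := h.symm; ENNReal.HolderConjugate.one_le _ p, h⟩

theorem mem_lpUnitBall_iff {p : ℝ≥0∞} (hp : 1 ≤ p) (m : ℝ × ℝ) :
    m ∈ lpUnitBall p ↔ lpCombine p |m.1| |m.2| ≤ 1 := by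
  rw [← norm_toLp_eq_lpCombine hp]
  rfl

theorem abs_mem_lpUnitBall {p : ℝ≥0∞} (hp : 1 ≤ p) {m : ℝ × ℝ} (hm : m ∈ lpUnitBall p) :
    (|m.1|, |m.2|) ∈ lpUnitBall p := by
  rw [mem_lpUnitBall_iff hp] at hm ⊢
  simpa only [abs_abs] using hm

theorem combo_mem_lpUnitBall {p : ℝ≥0∞} (hp : 1 ≤ p) {a b a' b' s t : ℝ}
    (h : (a, b) ∈ lpUnitBall p) (h' : (a', b') ∈ lpUnitBall p) (hs : 0 ≤ s) (ht : 0 ≤ t)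
    (hst : s + t = 1) : (s * a + t * a', s * b + t * b') ∈ lpUnitBall p := by
  have hg := isAbsSeminorm_lp hp
  have h1 := hg.add_le (s * a) (s * b) (t * a') (t * b')
  rw [hg.smul_nonneg hs, hg.smul_nonneg ht] at h1
  calc _ ≤ _ := h1
    _ ≤ s * 1 + t * 1 :=
      add_le_add (mul_le_mul_of_nonneg_left h hs) (mul_le_mul_of_nonneg_left h' ht)
    _ = 1 := by rw [mul_one, mul_one, hst]

theorem isCompact_lpUnitBall {p : ℝ≥0∞} (hp : 1 ≤ p) : IsCompact (lpUnitBall p) := by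
  have hg := isAbsSeminorm_lp hp
  refine (isCompact_Icc (a := ((-1 : ℝ), (-1 : ℝ))) (b := ((1 : ℝ), (1 : ℝ)))).of_isClosed_subset
    (isClosed_le hg.continuous continuous_const) fun m hm => ?_
  rw [mem_lpUnitBall_iff hp] at hm
  have h1 : |m.1| ≤ 1 := by
    refine le_trans ?_ hm
    conv_lhs => rw [← lpCombine_zero_right hp (abs_nonneg m.1)]
    exact lpCombine_mono (abs_nonneg _) le_rfl le_rfl (abs_nonneg _)
  have h2 : |m.2| ≤ 1 := by
    refine le_trans ?_ hm
    conv_lhs => rw [← lpCombine_zero_left hp (abs_nonneg m.2)]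
    exact lpCombine_mono le_rfl (abs_nonneg _) (abs_nonneg _) le_rfl
  exact ⟨⟨(abs_le.mp h1).1, (abs_le.mp h2).1⟩, ⟨(abs_le.mp h1).2, (abs_le.mp h2).2⟩⟩

/-- Duality of the `ℓₚ` and `ℓ_q` norms on the plane. -/
theorem isGreatest_lpUnitBall {p q : ℝ≥0∞} (hp : 1 ≤ p) [ENNReal.HolderConjugate p q] {a b : ℝ}
    (ha : 0 ≤ a) (hb : 0 ≤ b) :
    IsGreatest ((fun m : ℝ × ℝ => |m.1| * a + |m.2| * b) '' lpUnitBall p) (lpCombine q a b) := by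
  by_cases hpt : p = ∞
  · have hq : q = 1 := (ENNReal.HolderConjugate.eq_top_iff_eq_one p q).mp hpt
    subst hpt hq
    have hval : lpCombine 1 a b = a + b := by simp [lpCombine]
    rw [hval]
    refine ⟨⟨(1, 1), ?_, by simp⟩, ?_⟩
    · rw [mem_lpUnitBall_iff hp]
      simp [lpCombine]
    · rintro _ ⟨m, hm, rfl⟩
      rw [mem_lpUnitBall_iff hp, lpCombine, if_pos rfl, max_le_iff] at hm
      exact add_le_add (mul_le_of_le_one_left ha hm.1) (mul_le_of_le_one_left hb hm.2)
  by_cases hqt : q = ∞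
  · have hp1 : p = 1 := (ENNReal.HolderConjugate.eq_top_iff_eq_one q p).mp hqt
    subst hp1 hqt
    rw [lpCombine, if_pos rfl]
    refine ⟨?_, ?_⟩
    · rcases le_total a b with h | h
      · refine ⟨(0, 1), ?_, by simp [h]⟩
        rw [mem_lpUnitBall_iff hp]
        simp [lpCombine]
      · refine ⟨(1, 0), ?_, by simp [h]⟩
        rw [mem_lpUnitBall_iff hp]
        simp [lpCombine]
    · rintro _ ⟨m, hm, rfl⟩
      rw [mem_lpUnitBall_iff hp] at hm
      have hm' : |m.1| + |m.2| ≤ 1 := by simpa [lpCombine] using hm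
      calc |m.1| * a + |m.2| * b ≤ |m.1| * max a b + |m.2| * max a b :=
            add_le_add (mul_le_mul_of_nonneg_left (le_max_left _ _) (abs_nonneg _))
              (mul_le_mul_of_nonneg_left (le_max_right _ _) (abs_nonneg _))
        _ = (|m.1| + |m.2|) * max a b := by ring
        _ ≤ max a b := mul_le_of_le_one_left (le_max_of_le_left ha) hm'
  have hpq := ENNReal.HolderConjugate.toReal_of_ne_top (p := p) (q := q) hpt hqt
  have hpos := hpq.pos
  lift a to NNReal using ha
  lift b to NNReal using hb
  -- For finite exponents this is the extremal form of Hölder's inequality; `hpq.symm` puts the `q`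
  -- norm on `(a, b)` and the `p` ball on the multipliers.
  have hgr := NNReal.isGreatest_Lp Finset.univ ![a, b] hpq.symm
  have hmem : ∀ c d : NNReal,
      ((c : ℝ), (d : ℝ)) ∈ lpUnitBall p ↔ c ^ p.toReal + d ^ p.toReal ≤ 1 := by
    intro c d
    have h := Real.rpow_le_rpow_iff (x := (c : ℝ) ^ p.toReal + (d : ℝ) ^ p.toReal)
      (by positivity) zero_le_one (one_div_pos.mpr hpos)
    rw [Real.one_rpow] at h
    rw [mem_lpUnitBall_iff hp, lpCombine, if_neg hpt, NNReal.abs_eq, NNReal.abs_eq, h]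
    norm_cast
  have hval : lpCombine q a b =
      (((∑ i, ![a, b] i ^ q.toReal) ^ (1 / q.toReal) : NNReal) : ℝ) := by
    rw [lpCombine, if_neg hqt, Fin.sum_univ_two, NNReal.coe_rpow, NNReal.coe_add, NNReal.coe_rpow,
      NNReal.coe_rpow]
    rfl
  rw [hval]
  refine ⟨?_, ?_⟩
  · obtain ⟨f, hf, hfe⟩ := hgr.1
    rw [Set.mem_ofPred_eq, Fin.sum_univ_two] at hf
    refine ⟨(f 0, f 1), (hmem _ _).mpr hf, ?_⟩
    rw [← hfe]
    simp only [Fin.sum_univ_two, NNReal.abs_eq, NNReal.coe_add, NNReal.coe_mul]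
    rw [mul_comm, mul_comm (f 1 : ℝ)]
    rfl
  · rintro _ ⟨m, hm, rfl⟩
    have hm' := abs_mem_lpUnitBall hp hm
    simp only
    generalize hc : |m.1| = c at hm' ⊢
    generalize hd : |m.2| = d at hm' ⊢
    lift c to NNReal using hc ▸ abs_nonneg m.1
    lift d to NNReal using hd ▸ abs_nonneg m.2
    have h := hgr.2 ⟨![c, d], by
      rw [Set.mem_ofPred_eq, Fin.sum_univ_two]
      exact (hmem c d).mp hm', rfl⟩
    refine le_trans (le_of_eq ?_) (NNReal.coe_le_coe.mpr h)
    simp only [Fin.sum_univ_two, NNReal.coe_add, NNReal.coe_mul]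
    rw [mul_comm, mul_comm (d : ℝ)]
    rfl

/-- Symmetry absorbs the signs of the coefficients, and convexity merges the two points. This is
what makes the `M`-sum convex when `M` is an `ℓ_p` ball. -/
theorem exists_smul_add_smul {n : ℕ} (K : SymmCompactConvex n) (a b : ℝ) {x y : Eucl n}
    (hx : x ∈ (K.1 : Set (Eucl n))) (hy : y ∈ (K.1 : Set (Eucl n))) :
    ∃ z ∈ (K.1 : Set (Eucl n)), a • x + b • y = (|a| + |b|) • z := by
  have habs : ∀ (c : ℝ) (w : Eucl n), w ∈ (K.1 : Set (Eucl n)) →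
      ∃ w' ∈ (K.1 : Set (Eucl n)), c • w = |c| • w' := by
    intro c w hw
    rcases le_total 0 c with hc | hc
    · exact ⟨w, hw, by rw [abs_of_nonneg hc]⟩
    · exact ⟨-w, K.2 w hw, by rw [abs_of_nonpos hc, neg_smul_neg]⟩
  obtain ⟨x', hx', hax⟩ := habs a x hx
  obtain ⟨y', hy', hby⟩ := habs b y hy
  rw [hax, hby]
  rcases (add_nonneg (abs_nonneg a) (abs_nonneg b)).eq_or_lt with h | h
  · have ha : |a| = 0 := by linarith [abs_nonneg a, abs_nonneg b]
    have hb : |b| = 0 := by linarith [abs_nonneg a, abs_nonneg b]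
    exact ⟨x, hx, by rw [ha, hb]; simp⟩
  · refine ⟨(|a| / (|a| + |b|)) • x' + (|b| / (|a| + |b|)) • y',
      K.1.convex hx' hy' (by positivity) (by positivity) (by field_simp), ?_⟩
    rw [smul_add, smul_smul, smul_smul, mul_div_cancel₀ _ h.ne', mul_div_cancel₀ _ h.ne']

theorem convex_mSum_lpUnitBall {n : ℕ} {p : ℝ≥0∞} (hp : 1 ≤ p) (K L : SymmCompactConvex n) :
    Convex ℝ (mSum (lpUnitBall p) (K.1 : Set (Eucl n)) (L.1 : Set (Eucl n))) := by
  rintro _ ⟨x, hx, y, hy, m, hm, rfl⟩ _ ⟨x', hx', y', hy', m', hm', rfl⟩ s t hs ht hst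
  obtain ⟨z, hz, hxz⟩ := exists_smul_add_smul K (s * m.1) (t * m'.1) hx hx'
  obtain ⟨w, hw, hyw⟩ := exists_smul_add_smul L (s * m.2) (t * m'.2) hy hy'
  rw [abs_mul, abs_mul, abs_of_nonneg hs, abs_of_nonneg ht] at hxz hyw
  refine ⟨z, hz, w, hw, _, combo_mem_lpUnitBall hp (abs_mem_lpUnitBall hp hm)
    (abs_mem_lpUnitBall hp hm') hs ht hst, ?_⟩
  rw [← hxz, ← hyw]
  module

theorem isCompact_mSum {n : ℕ} {M : Set (ℝ × ℝ)} (hM : IsCompact M) {K L : Set (Eucl n)}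
    (hK : IsCompact K) (hL : IsCompact L) : IsCompact (mSum M K L) := by
  have himg : mSum M K L =
      (fun P : (ℝ × ℝ) × Eucl n × Eucl n => P.1.1 • P.2.1 + P.1.2 • P.2.2) '' M ×ˢ K ×ˢ L := by
    ext z
    constructor
    · rintro ⟨x, hx, y, hy, m, hm, rfl⟩
      exact ⟨(m, x, y), ⟨hm, hx, hy⟩, rfl⟩
    · rintro ⟨⟨m, x, y⟩, ⟨hm, hx, hy⟩, rfl⟩
      exact ⟨x, hx, y, hy, m, hm, rfl⟩
  rw [himg]
  exact (hM.prod (hK.prod hL)).image (by fun_prop)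

theorem abs_inner_le_supportFn {n : ℕ} (K : SymmCompactConvex n) (u : Eucl n) {x : Eucl n}
    (hx : x ∈ (K.1 : Set (Eucl n))) : |inner ℝ u x| ≤ supportFn K.1 u :=
  abs_le'.mpr ⟨inner_le_supportFn _ u hx, by
    rw [← inner_neg_right]
    exact inner_le_supportFn _ u (K.2 x hx)⟩

theorem exists_inner_eq_supportFn {n : ℕ} (K : CompactConvex n) (u : Eucl n) :
    ∃ x ∈ (K : Set (Eucl n)), inner ℝ u x = supportFn K u :=
  (K.isCompact.image (f := fun y => inner ℝ u y) (by fun_prop)).sSup_mem (K.nonempty.image _)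

/-- By symmetry of `K` and `L`, the support function of the `M`-sum at `u` is the maximum of `|m.1|
* h_K(u) + |m.2| * h_L(u)` over `m ∈ M`, which for the `ℓ_p` ball is the dual norm `ℓ_q` of
`(h_K(u), h_L(u))`. -/
theorem coe_lpAdd_eq_mSum {n : ℕ} {p q : ℝ≥0∞} (hp : 1 ≤ p) (hq : 1 ≤ q)
    [ENNReal.HolderConjugate p q] (K L : SymmCompactConvex n) :
    (lpAdd q hq K L : Set (Eucl n)) =
      mSum (lpUnitBall p) (K.1 : Set (Eucl n)) (L.1 : Set (Eucl n)) := by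
  have hball : ((0 : ℝ), (0 : ℝ)) ∈ lpUnitBall p := by
    change ‖WithLp.toLp p ((0 : ℝ), (0 : ℝ))‖ ≤ 1
    rw [(isAbsSeminorm_lp hp).zero]
    exact zero_le_one
  obtain ⟨x₀, hx₀⟩ := K.1.nonempty
  obtain ⟨y₀, hy₀⟩ := L.1.nonempty
  suffices h : lpAdd q hq K L = ⟨_, convex_mSum_lpUnitBall hp K L,
      isCompact_mSum (isCompact_lpUnitBall hp) K.1.isCompact L.1.isCompact,
      ⟨_, x₀, hx₀, y₀, hy₀, _, hball, rfl⟩⟩ by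
    rw [h]
    rfl
  refine eq_of_supportFn_eq fun u => ?_
  obtain ⟨⟨m, hm, hmax⟩, hub⟩ :=
    isGreatest_lpUnitBall (q := q) hp (supportFn_nonneg K u) (supportFn_nonneg L u)
  rw [supportFn_lpAdd]
  refine le_antisymm ?_ (supportFn_le _ u ?_)
  · obtain ⟨x, hx, hxu⟩ := exists_inner_eq_supportFn K.1 u
    obtain ⟨y, hy, hyu⟩ := exists_inner_eq_supportFn L.1 u
    rw [← hmax, ← hxu, ← hyu]
    simp only [← real_inner_smul_right, ← inner_add_right]
    exact inner_le_supportFn _ u ⟨x, hx, y, hy, _, abs_mem_lpUnitBall hp hm, rfl⟩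
  · rintro _ ⟨x, hx, y, hy, m', hm', rfl⟩
    refine le_trans ?_ (hub ⟨m', hm', rfl⟩)
    rw [inner_add_right, real_inner_smul_right, real_inner_smul_right]
    refine add_le_add ((le_abs_self _).trans ?_) ((le_abs_self _).trans ?_) <;> rw [abs_mul]
    · exact mul_le_mul_of_nonneg_left (abs_inner_le_supportFn K u hx) (abs_nonneg _)
    · exact mul_le_mul_of_nonneg_left (abs_inner_le_supportFn L u hy) (abs_nonneg _)

theorem exists_isMAddition_lpUnitBall_iff {n : ℕ} (op : BinOp n) :
    (∃ p : ℝ≥0∞, 1 ≤ p ∧ IsMAddition op (lpUnitBall p)) ↔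
      ∃ (q : ℝ≥0∞) (hq : 1 ≤ q), op = lpAdd q hq := by
  constructor
  · rintro ⟨p, hp, h⟩
    obtain ⟨q, hq, hpq⟩ := exists_holderConjugate hp
    exact ⟨q, hq, funext fun K => funext fun L => ConvexBody.ext
      ((h K L).trans (coe_lpAdd_eq_mSum hp hq K L).symm)⟩
  · rintro ⟨q, hq, rfl⟩
    obtain ⟨p, hp, hqp⟩ := exists_holderConjugate hq
    have := hqp.symm
    exact ⟨p, hp, fun K L => coe_lpAdd_eq_mSum hp hq K L⟩

/-! ### `M`-addition for the origin and the unit segments of the axes -/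

/-- The point `c • x` is a convex combination of `x` and `-x`. -/
theorem smul_mem_of_abs_le_one {n : ℕ} (K : SymmCompactConvex n) {c : ℝ} (hc : |c| ≤ 1)
    {x : Eucl n} (hx : x ∈ (K.1 : Set (Eucl n))) : c • x ∈ (K.1 : Set (Eucl n)) := by
  have h := K.1.convex hx (K.2 x hx) (a := (1 + c) / 2) (b := (1 - c) / 2)
    (by linarith [(abs_le.mp hc).1]) (by linarith [(abs_le.mp hc).2]) (by ring)
  convert h using 1
  module

theorem mSum_singleton_zero {n : ℕ} (K L : CompactConvex n) :
    mSum {(0, 0)} (K : Set (Eucl n)) (L : Set (Eucl n)) = {0} := by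
  obtain ⟨x, hx⟩ := K.nonempty
  obtain ⟨y, hy⟩ := L.nonempty
  ext z
  constructor
  · rintro ⟨x, -, y, -, m, rfl, rfl⟩
    simp
  · rintro rfl
    exact ⟨x, hx, y, hy, _, rfl, by simp⟩

theorem mSum_segment_fst {n : ℕ} (K L : SymmCompactConvex n) :
    mSum (segment ℝ (-1, 0) (1, 0)) (K.1 : Set (Eucl n)) (L.1 : Set (Eucl n)) = K.1 := by
  obtain ⟨y, hy⟩ := L.1.nonempty
  ext z
  constructor
  · rintro ⟨x, hx, y, -, m, ⟨s, t, hs, ht, hst, rfl⟩, rfl⟩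
    have := smul_mem_of_abs_le_one K (c := t - s) (abs_le.mpr ⟨by linarith, by linarith⟩) hx
    convert this using 1
    simp
    ring_nf
  · intro hz
    exact ⟨z, hz, y, hy, _, right_mem_segment ℝ _ _, by simp⟩

theorem mSum_segment_snd {n : ℕ} (K L : SymmCompactConvex n) :
    mSum (segment ℝ (0, -1) (0, 1)) (K.1 : Set (Eucl n)) (L.1 : Set (Eucl n)) = L.1 := by
  obtain ⟨x, hx⟩ := K.1.nonempty
  ext z
  constructor
  · rintro ⟨x, -, y, hy, m, ⟨s, t, hs, ht, hst, rfl⟩, rfl⟩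
    have := smul_mem_of_abs_le_one L (c := t - s) (abs_le.mpr ⟨by linarith, by linarith⟩) hy
    convert this using 1
    simp
    ring_nf
  · intro hz
    exact ⟨x, hx, z, hz, _, right_mem_segment ℝ _ _, by simp⟩

theorem isMAddition_classification_iff {n : ℕ} (op : BinOp n) :
    (IsMAddition op {(0, 0)} ∨ IsMAddition op (segment ℝ (-1, 0) (1, 0)) ∨
      IsMAddition op (segment ℝ (0, -1) (0, 1)) ∨
      ∃ p : ℝ≥0∞, 1 ≤ p ∧ IsMAddition op (lpUnitBall p)) ↔
    (∀ K L, (op K L : Set (Eucl n)) = {0}) ∨ (∀ K L, op K L = K.1) ∨ (∀ K L, op K L = L.1) ∨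
      ∃ (p : ℝ≥0∞) (hp : 1 ≤ p), op = lpAdd p hp := by
  rw [exists_isMAddition_lpUnitBall_iff]
  simp only [IsMAddition, mSum_singleton_zero, mSum_segment_fst, mSum_segment_snd,
    SetLike.coe_set_eq]

end ConvexOps

theorem theorem7p8 (n : ℕ) (hn : 2 ≤ n) (op : ConvexOps.BinOp n) :
    -- projection covariance is continuity together with `GL(n)` covariance
    (ConvexOps.ProjectionCovariant op ↔
      ConvexOps.HausdorffContinuous op ∧ ConvexOps.GLCovariant op) ∧
    -- a projection covariant operation has only `o`-symmetric values
    (ConvexOps.ProjectionCovariant op →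
      ∀ K L, ConvexOps.IsOSymm (op K L : Set (ConvexOps.Eucl n))) ∧
    -- the classification in terms of `M`-addition
    (ConvexOps.ProjectionCovariant op ∧ ConvexOps.Associative op ↔
      ConvexOps.IsMAddition op {(0, 0)} ∨
      ConvexOps.IsMAddition op (segment ℝ (-1, 0) (1, 0)) ∨
      ConvexOps.IsMAddition op (segment ℝ (0, -1) (0, 1)) ∨
      ∃ p : ENNReal, 1 ≤ p ∧ ConvexOps.IsMAddition op (ConvexOps.lpUnitBall p)) ∧
    -- the classification in terms of `Lₚ` addition
    (ConvexOps.ProjectionCovariant op ∧ ConvexOps.Associative op ↔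
      (∀ K L, (op K L : Set (ConvexOps.Eucl n)) = {0}) ∨
      (∀ K L, op K L = K.1) ∨
      (∀ K L, op K L = L.1) ∨
      ∃ (p : ENNReal) (hp : 1 ≤ p), op = ConvexOps.lpAdd p hp) ∧
    -- with the identity property only `Lₚ` addition remains
    (ConvexOps.HausdorffContinuous op ∧ ConvexOps.GLCovariant op ∧
        ConvexOps.Associative op ∧ ConvexOps.HasIdentity op ↔
      ∃ (p : ENNReal) (hp : 1 ≤ p), op = ConvexOps.lpAdd p hp) ∧
    (ConvexOps.ProjectionCovariant op ∧
        ConvexOps.Associative op ∧ ConvexOps.HasIdentity op ↔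
      ∃ (p : ENNReal) (hp : 1 ≤ p), op = ConvexOps.lpAdd p hp) := by
  have hcov := ConvexOps.projectionCovariant_iff hn op
  have hclass := ConvexOps.projectionCovariant_and_associative_iff hn op
  have hid := ConvexOps.projectionCovariant_and_associative_and_hasIdentity_iff hn op
  refine ⟨hcov, fun hop K L => ?_, ?_, hclass, ?_, hid⟩
  · obtain ⟨g, -, hg⟩ := hop.exists_isGivenBy hn
    exact hg.isOSymm K L
  · rw [ConvexOps.isMAddition_classification_iff]
    exact hclass
  · rw [← hid, hcov, and_assoc]
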